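/- Let $\lambda>0$ and let $\xi_1,\xi_2,\ldots$ be i.i.d. with $\mathbf P(\xi_k=1)=1-\mathbf P(\xi_k=-1)=\frac{e^{\lambda}}{e^{\lambda}+e^{-\lambda}}$, and put $Y_n=\sum_{k=1}^n\xi_k$ for $n\in\mathbb N_0$. Let $(w_x)_{x\in\mathbb Z}$ be a family of positive (finite) random variables that is stationary and ergodic under the shift of $\mathbb Z$. Let $(\tau_{r,x,k})_{r\ge 0}$, $x\in\mathbb Z$, $k\in\mathbb N_0$, be i.i.d. stochastic processes with values in $[0,\infty)$ and right-continuous paths that have left limits on $(0,\infty)$, such that $\mathbf E[\tau_{r,x,k}]=r$ for all $r\ge 0$. Suppose that the three families $(\xi_k)$, $(w_x)$ and $(\tau_{r,x,k})$ are independent of each other. Let $$T_n=\sum_{k=0}^{n-1}\tau_{w_{Y_k},Y_k,k}\quad(n\in\mathbb N_0),\qquad X_t=Y_k\ \text{ for } T_k\le t<T_{k+1}.$$ Then, almost surely, $X_t$ is well defined for all $t\ge 0$ (for every $t\ge0$ there is exactly one $k$ with $T_k\le t<T_{k+1}$). Let $p_{\mathrm{esc}}(\lambda)=\mathbf P(Y_n\neq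 0\text{ for all }n\ge 1)$ be the escape probability. Then $p_{\mathrm{esc}}(\lambda)=\tanh(\lambda)=\frac{e^\lambda-e^{-\lambda}}{e^\lambda+e^{-\lambda}}$, the limit $\overline{\mathrm v}=\lim_{t\to\infty}X_t/t$ exists almost surely, and $$\overline{\mathrm v}=\frac{p_{\mathrm{esc}}(\lambda)}{\mathbf E[w_0]}\quad\text{almost surely,}$$ where the right-hand side is $0$ if $\mathbf E[w_0]=\infty$. -/

import Mathlib

open MeasureTheory ProbabilityTheory Filter Topology
open scoped NNReal ENNReal

noncomputable section

namespace TrappedWalk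

/-- `f : [0,∞) → [0,∞)` is càdlàg: right-continuous everywhere, with (finite) left limits at all
points of `(0,∞)`. -/
def IsCadlag (f : ℝ≥0 → ℝ≥0) : Prop :=
  (∀ r, ContinuousWithinAt f (Set.Ici r) r) ∧
    ∀ r, 0 < r → ∃ l, Tendsto f (𝓝[<] r) (𝓝 l)

/-- The shift on sequences indexed by `ℤ`. -/
def shift (v : ℤ → ℝ≥0) : ℤ → ℝ≥0 := fun x => v (x + 1)

/-- Probability of a step to the right, for the bias `lam`. -/
def stepProb (lam : ℝ) : ℝ := Real.exp lam / (Real.exp lam + Real.exp (-lam))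

variable {Ω : Type*}

/-- The discrete-time walk `Y n = ξ₁ + ⋯ + ξₙ`; here `ξ ω k` is the `(k+1)`-st step. -/
def walk (ξ : Ω → ℕ → ℤ) (n : ℕ) (ω : Ω) : ℤ := ∑ k ∈ Finset.range n, ξ ω k

/-- The jump times `T n = ∑_{k < n} τ_{w_{Y_k}, Y_k, k}`; here `τ ω x k r` is `τ_{r,x,k}`. -/
def jumpTime (ξ : Ω → ℕ → ℤ) (w : Ω → ℤ → ℝ≥0) (τ : Ω → ℤ → ℕ → ℝ≥0 → ℝ≥0)
    (n : ℕ) (ω : Ω) : ℝ≥0 :=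
  ∑ k ∈ Finset.range n, τ ω (walk ξ k ω) k (w ω (walk ξ k ω))

open Classical in
/-- The continuous-time walk: `X t = Y k` for `T k ≤ t < T (k+1)`. (Since the `T k` are
nondecreasing there is at most one such `k`; if there is none, the value is `0`.) -/
def position (ξ : Ω → ℕ → ℤ) (w : Ω → ℤ → ℝ≥0) (τ : Ω → ℤ → ℕ → ℝ≥0 → ℝ≥0)
    (t : ℝ≥0) (ω : Ω) : ℤ :=
  if h : ∃ k, jumpTime ξ w τ k ω ≤ t ∧ t < jumpTime ξ w τ (k + 1) ω then
    walk ξ (Nat.find h) ω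
  else 0

variable [MeasurableSpace Ω]

/-- The escape probability `P(Y n ≠ 0 for all n ≥ 1)`. -/
def escapeProb (P : Measure Ω) (ξ : Ω → ℕ → ℤ) : ℝ≥0∞ :=
  P {ω | ∀ n, 1 ≤ n → walk ξ n ω ≠ 0}

/-- The assumptions of the model with bias `lam`: steps `ξ`, environment `w` of mean holding times,
holding-time processes `τ`. Spaces of paths carry the product σ-algebra; on càdlàg paths this is
the Borel σ-algebra of the Skorohod space. -/
structure IsModel (P : Measure Ω) (lam : ℝ) (ξ : Ω → ℕ → ℤ) (w : Ω → ℤ → ℝ≥0)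
    (τ : Ω → ℤ → ℕ → ℝ≥0 → ℝ≥0) : Prop where
  measurable_step : Measurable ξ
  measurable_env : Measurable w
  measurable_hold : Measurable τ
  /-- The steps are i.i.d., `1` with probability `stepProb lam` and `-1` otherwise. -/
  step_indep : iIndepFun (fun k ω => ξ ω k) P
  step_right : ∀ k, P {ω | ξ ω k = 1} = ENNReal.ofReal (stepProb lam)
  step_left : ∀ k, P {ω | ξ ω k = -1} = ENNReal.ofReal (1 - stepProb lam)
  /-- The environment is positive and its law is invariant and ergodic under the shift. -/
  env_pos : ∀ x, ∀ᵐ ω ∂P, 0 < w ω x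
  env_ergodic : Ergodic shift (P.map w)
  /-- The processes `(τ_{r,x,k})_{r ≥ 0}` are càdlàg, i.i.d. in `(x,k)`, and `E[τ_{r,x,k}] = r`. -/
  hold_cadlag : ∀ ω x k, IsCadlag (τ ω x k)
  hold_indep : iIndepFun (fun (i : ℤ × ℕ) ω => τ ω i.1 i.2) P
  hold_identDistrib : ∀ i j : ℤ × ℕ,
    IdentDistrib (fun ω => τ ω i.1 i.2) (fun ω => τ ω j.1 j.2) P P
  hold_mean : ∀ x k r, ∫⁻ ω, (τ ω x k r : ℝ≥0∞) ∂P = r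
  /-- The three families `w`, `τ`, `ξ` are (mutually) independent. -/
  env_indep_hold : IndepFun w τ P
  step_indep_env_hold : IndepFun ξ (fun ω => (w ω, τ ω)) P

end TrappedWalk

end

/-! View the model from the walker. The step and the holding-time process used at time `k` form an
i.i.d. sequence in `k`, independent of the environment (`map_pairAlong`, `IsModel.map_driving`): the
time index prevents any process from being used twice. Shifting this sequence while translating the
environment by the first step, `envStep`, preserves the product law. The walk is the Birkhoff sum of
the step and `T n` that of `currentHold`, whose mean is `E[w 0]`. Birkhoff's theorem, with a version
for infinite mean, then gives `Y n / n → tanh lam` and `T n / n → E[w 0]`. With `κ` the index of the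
current jump interval, `X t / t = (Y κ / κ) (κ / t)`, and the speed follows.

The crux is ergodicity of `envStep`. By the Markov property, the conditional probability of an
invariant event, given the environment and the first `n` terms, is a function of the environment
seen at time `n`. Martingale convergence and stationarity force this function into `{0, 1}`
(`ae_envProb_eq_zero_or_one`). It is harmonic, so its level set at `1` is carried into itself by a
step to the right, and ergodicity of the shift makes that set null or full.

The escape probability comes from the maximal functions behind the ergodic theorem. The positive
part of the minimum of `Y 1, …, Y (n+1)` is the indicator of staying positive
(`step_add_maxSum_sub`). Its mean is the drift plus the mean increment of a bounded increasing
sequence, which vanishes in the limit. -/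

noncomputable section

namespace TrappedWalk

/-! ### Maximal functions and the pointwise ergodic theorem -/

section Birkhoff

variable {E : Type*}

/-- The maximum of the Birkhoff sums of `f` of lengths `0, …, n`. -/
def maxSum (S : E → E) (f : E → ℝ) : ℕ → E → ℝ
  | 0 => fun _ => 0
  | n + 1 => fun x => max 0 (f x + maxSum S f n (S x))

lemma maxSum_succ (S : E → E) (f : E → ℝ) (n : ℕ) (x : E) :
    maxSum S f (n + 1) x = max 0 (f x + maxSum S f n (S x)) := rfl

lemma maxSum_nonneg (S : E → E) (f : E → ℝ) (n : ℕ) (x : E) : 0 ≤ maxSum S f n x := by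
  cases n with
  | zero => exact le_rfl
  | succ n => exact le_max_left _ _

lemma maxSum_le_succ (S : E → E) (f : E → ℝ) (n : ℕ) (x : E) :
    maxSum S f n x ≤ maxSum S f (n + 1) x := by
  induction n generalizing x with
  | zero => exact maxSum_nonneg S f 1 x
  | succ n ih =>
    rw [maxSum_succ S f n, maxSum_succ S f (n + 1)]
    gcongr
    exact ih (S x)

lemma monotone_maxSum (S : E → E) (f : E → ℝ) (x : E) : Monotone fun n => maxSum S f n x :=
  monotone_nat_of_le_succ fun n => maxSum_le_succ S f n x

lemma birkhoffSum_le_maxSum (S : E → E) (f : E → ℝ) {k n : ℕ} (hk : k ≤ n) (x : E) :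
    birkhoffSum S f k x ≤ maxSum S f n x := by
  induction n generalizing k x with
  | zero =>
    obtain rfl : k = 0 := by omega
    simp [maxSum]
  | succ n ih =>
    cases k with
    | zero => simpa using maxSum_nonneg S f (n + 1) x
    | succ k =>
      rw [birkhoffSum_succ', maxSum_succ]
      exact le_max_of_le_right (by gcongr; exact ih (by omega) _)

lemma exists_birkhoffSum_eq_maxSum (S : E → E) (f : E → ℝ) (n : ℕ) (x : E) :
    ∃ k ≤ n, maxSum S f n x = birkhoffSum S f k x := by
  induction n generalizing x with
  | zero => exact ⟨0, le_rfl, by simp [maxSum]⟩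
  | succ n ih =>
    rw [maxSum_succ]
    rcases max_choice 0 (f x + maxSum S f n (S x)) with h | h
    · exact ⟨0, by omega, by simp [h]⟩
    · obtain ⟨k, hk, e⟩ := ih (S x)
      exact ⟨k + 1, by omega, by rw [h, e, birkhoffSum_succ']⟩

/-- Supplies the dominating function when increments of `maxSum` are integrated for the escape
probability. -/
lemma maxSum_succ_sub_le (S : E → E) (f : E → ℝ) (hf : ∀ x, f x ≤ 1) (n : ℕ) (x : E) :
    maxSum S f (n + 1) x - maxSum S f n x ≤ 1 := by
  induction n generalizing x with
  | zero => simpa [maxSum] using hf x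
  | succ n ih =>
    have := ih (S x)
    rw [maxSum_succ S f n, maxSum_succ S f (n + 1), sub_le_iff_le_add]
    refine max_le ?_ ?_
    · have := le_max_left 0 (f x + maxSum S f n (S x))
      linarith
    · have := le_max_right 0 (f x + maxSum S f n (S x))
      linarith

/-- Comparing with `maxSum S f n (S x)` instead of `maxSum S f n x` isolates `f x`: the difference
is exactly `f x` once the maximum at `S x` exceeds `-f x`. -/
lemma maxSum_succ_sub_comp (S : E → E) (f : E → ℝ) (n : ℕ) (x : E) :
    maxSum S f (n + 1) x - maxSum S f n (S x) = max (-maxSum S f n (S x)) (f x) := by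
  rw [maxSum_succ, sub_eq_iff_eq_add, max_add]
  simp

variable [MeasurableSpace E] {μ : Measure E} {S : E → E} {f : E → ℝ}

lemma measurable_maxSum (hS : Measurable S) (hf : Measurable f) (n : ℕ) :
    Measurable (maxSum S f n) := by
  induction n with
  | zero => exact measurable_const
  | succ n ih => exact measurable_const.max (hf.add (ih.comp hS))

lemma integrable_maxSum (hS : MeasurePreserving S μ μ) (hf : Integrable f μ) (n : ℕ) :
    Integrable (maxSum S f n) μ := by
  induction n with
  | zero => exact integrable_zero _ _ _
  | succ n ih => exact (integrable_zero _ _ _).sup (hf.add (hS.integrable_comp_of_integrable ih))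

/-- Invariance of `μ` trades the difference controlled by `f` for the increment in `n`, which is
nonnegative. -/
lemma integral_maxSum_succ_sub_comp (hS : MeasurePreserving S μ μ) (hfm : Measurable f)
    (hf : Integrable f μ) (n : ℕ) :
    ∫ x, (maxSum S f (n + 1) x - maxSum S f n (S x)) ∂μ =
      ∫ x, (maxSum S f (n + 1) x - maxSum S f n x) ∂μ := by
  have h1 := integrable_maxSum hS hf (n + 1)
  have h2 := integrable_maxSum hS hf n
  have h3 : Integrable (fun x => maxSum S f n (S x)) μ := hS.integrable_comp_of_integrable h2
  rw [integral_sub h1 h2, integral_sub h1 h3]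
  congr 1
  rw [← integral_map (f := maxSum S f n) hS.aemeasurable, hS.map_eq]
  exact (measurable_maxSum hS.measurable hfm n).aestronglyMeasurable

lemma measurableSet_bddAbove_maxSum (hS : Measurable S) (hf : Measurable f) :
    MeasurableSet {x | ∃ C : ℕ, ∀ n, maxSum S f n x ≤ C} := by
  simp only [Set.ofPred_exists, Set.ofPred_forall]
  exact .iUnion fun C => .iInter fun n =>
    measurableSet_le (measurable_maxSum hS hf n) measurable_const

/-- The maximal ergodic lemma for ergodic maps: the Birkhoff sums of a function with negative mean
are almost surely bounded above. -/
lemma ae_bddAbove_maxSum (hS : Ergodic S μ) (hfm : Measurable f) (hf : Integrable f μ)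
    (hneg : ∫ x, f x ∂μ < 0) : ∀ᵐ x ∂μ, ∃ C : ℕ, ∀ n, maxSum S f n x ≤ C := by
  set A := {x | ∃ C : ℕ, ∀ n, maxSum S f n x ≤ C} with hA
  -- By the recursion, boundedness at `x` and at `S x` differ only by the finite term `f x`.
  have hinv : S ⁻¹' A = A := by
    ext x
    simp only [hA, Set.mem_preimage, Set.mem_ofPred_eq]
    constructor
    · rintro ⟨C, hC⟩
      obtain ⟨D, hD⟩ := exists_nat_ge (max 0 (f x + C))
      refine ⟨D, fun n => ?_⟩
      refine (maxSum_le_succ S f n x).trans (le_trans ?_ hD)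
      rw [maxSum_succ]
      gcongr
      exact hC n
    · rintro ⟨C, hC⟩
      obtain ⟨D, hD⟩ := exists_nat_ge (C - f x)
      refine ⟨D, fun n => le_trans ?_ hD⟩
      have h1 := hC (n + 1)
      rw [maxSum_succ] at h1
      have := le_max_right 0 (f x + maxSum S f n (S x))
      linarith
  rcases hS.toPreErgodic.ae_mem_or_ae_notMem
    (measurableSet_bddAbove_maxSum hS.measurable hfm) hinv with h | h
  · exact h
  exfalso
  -- If the maxima are a.s. unbounded, the differences equal `f` from some `n` on and are dominated
  -- by `|f|`. Their integrals are nonnegative, which contradicts the negative mean.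
  have hlim : Tendsto (fun n => ∫ x, (maxSum S f (n + 1) x - maxSum S f n (S x)) ∂μ) atTop
      (𝓝 (∫ x, f x ∂μ)) := by
    refine tendsto_integral_of_dominated_convergence (fun x => |f x|) (fun n => ?_) hf.abs ?_ ?_
    · exact ((measurable_maxSum hS.measurable hfm _).sub
        ((measurable_maxSum hS.measurable hfm _).comp hS.measurable)).aestronglyMeasurable
    · refine fun n => ae_of_all _ fun x => ?_
      rw [maxSum_succ_sub_comp, Real.norm_eq_abs, abs_le]
      have := maxSum_nonneg S f n (S x)
      refine ⟨(neg_abs_le _).trans (le_max_right _ _), max_le ?_ (le_abs_self _)⟩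
      linarith [abs_nonneg (f x)]
    · filter_upwards [h] with x hx
      have hx' : S x ∉ A := by rwa [← Set.mem_preimage, hinv]
      obtain ⟨C, hC⟩ := exists_nat_ge (-f x)
      simp only [hA, Set.mem_ofPred_eq, not_exists, not_forall, not_le] at hx'
      obtain ⟨N, hN⟩ := hx' C
      refine tendsto_atTop_of_eventually_const (i₀ := N) fun n hn => ?_
      rw [maxSum_succ_sub_comp, max_eq_right]
      have : maxSum S f N (S x) ≤ maxSum S f n (S x) := monotone_maxSum S f (S x) hn
      linarith
  refine hneg.not_ge (ge_of_tendsto' hlim fun n => ?_)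
  rw [integral_maxSum_succ_sub_comp hS.toMeasurePreserving hfm hf]
  exact integral_nonneg fun x => sub_nonneg.2 (maxSum_le_succ S f n x)

lemma ae_eventually_birkhoffSum_div_le [IsProbabilityMeasure μ] (hS : Ergodic S μ)
    (hfm : Measurable f) (hf : Integrable f μ) {c : ℝ} (hc : ∫ x, f x ∂μ < c) :
    ∀ᵐ x ∂μ, ∀ᶠ n : ℕ in atTop, birkhoffSum S f n x / n ≤ c := by
  -- The function `f - d` has negative mean, so the sums of `f` are at most `n * d + C`, hence at
  -- most `n * c` once `n ≥ C / (c - d)`.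
  obtain ⟨d, hd, hdc⟩ := exists_between hc
  have := ae_bddAbove_maxSum hS (f := fun x => f x - d) (hfm.sub measurable_const)
    (hf.sub (integrable_const _)) (by
      rw [integral_sub hf (integrable_const _)]
      simpa using hd)
  filter_upwards [this] with x ⟨C, hC⟩
  filter_upwards [tendsto_natCast_atTop_atTop.eventually_ge_atTop (C / (c - d)),
    eventually_gt_atTop 0] with n hn hn0
  have h0 : (0 : ℝ) < n := by exact_mod_cast hn0
  have h1 := (birkhoffSum_le_maxSum S (fun x => f x - d) le_rfl x).trans (hC n)
  have h2 : birkhoffSum S (fun x => f x - d) n x = birkhoffSum S f n x - n * d := by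
    simp [birkhoffSum]
  rw [div_le_iff₀ (by linarith)] at hn
  rw [div_le_iff₀ h0]
  nlinarith

/-- **Birkhoff's pointwise ergodic theorem** for ergodic maps. -/
theorem ae_tendsto_birkhoffSum_div [IsProbabilityMeasure μ] (hS : Ergodic S μ)
    (hfm : Measurable f) (hf : Integrable f μ) :
    ∀ᵐ x ∂μ, Tendsto (fun n : ℕ => birkhoffSum S f n x / n) atTop (𝓝 (∫ x, f x ∂μ)) := by
  have h1 : ∀ᵐ x ∂μ, ∀ k : ℕ, ∀ᶠ n : ℕ in atTop,
      birkhoffSum S f n x / n ≤ ∫ x, f x ∂μ + 1 / ((k : ℝ) + 1) :=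
    ae_all_iff.2 fun k => ae_eventually_birkhoffSum_div_le hS hfm hf
      (lt_add_of_pos_right _ (by positivity))
  have h2 : ∀ᵐ x ∂μ, ∀ k : ℕ, ∀ᶠ n : ℕ in atTop,
      birkhoffSum S (fun x => -f x) n x / n ≤ ∫ x, -f x ∂μ + 1 / ((k : ℝ) + 1) :=
    ae_all_iff.2 fun k => ae_eventually_birkhoffSum_div_le hS hfm.neg hf.neg
      (lt_add_of_pos_right _ (by positivity))
  filter_upwards [h1, h2] with x h1 h2
  refine Metric.tendsto_nhds.2 fun ε hε => ?_
  obtain ⟨k, hk⟩ := exists_nat_one_div_lt hε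
  filter_upwards [h1 k, h2 k] with n h1 h2
  have e : birkhoffSum S (fun x => -f x) n x = -birkhoffSum S f n x := by simp [birkhoffSum]
  rw [e, integral_neg, neg_div] at h2
  rw [Real.dist_eq, abs_lt]
  constructor <;> linarith

/-- The ergodic theorem for nonnegative functions with infinite mean. -/
theorem ae_tendsto_birkhoffSum_div_atTop [IsProbabilityMeasure μ] (hS : Ergodic S μ)
    {f : E → ℝ≥0} (hfm : Measurable f) (hf : ∫⁻ x, f x ∂μ = ∞) :
    ∀ᵐ x ∂μ, Tendsto (fun n : ℕ => birkhoffSum S (fun x => (f x : ℝ)) n x / n) atTop atTop := by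
  -- The truncations at `M` are integrable and bound `f` from below; their means tend to infinity by
  -- monotone convergence.
  set g : ℕ → E → ℝ := fun M x => (min (f x) M : ℝ≥0) with hg
  have hgm M : Measurable (g M) := by fun_prop
  have hgi M : Integrable (g M) μ := by
    refine Integrable.of_bound (hgm M).aestronglyMeasurable M (ae_of_all _ fun x => ?_)
    rw [Real.norm_of_nonneg (NNReal.coe_nonneg _)]
    simp
  have hlim : Tendsto (fun M => ∫ x, g M x ∂μ) atTop atTop := by
    have h1 : Tendsto (fun M : ℕ => ∫⁻ x, ((min (f x) M : ℝ≥0) : ℝ≥0∞) ∂μ) atTop (𝓝 ∞) := by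
      rw [← hf]
      refine lintegral_tendsto_of_tendsto_of_monotone (fun M => by fun_prop)
        (ae_of_all _ fun x M N h => ?_) (ae_of_all _ fun x => ?_)
      · simp only
        gcongr
      · obtain ⟨N, hN⟩ := exists_nat_ge (f x)
        refine tendsto_atTop_of_eventually_const (i₀ := N) fun n hn => ?_
        rw [min_eq_left]
        exact hN.trans (by exact_mod_cast hn)
    have h2 M : ENNReal.ofReal (∫ x, g M x ∂μ) = ∫⁻ x, ((min (f x) M : ℝ≥0) : ℝ≥0∞) ∂μ := by
      rw [ofReal_integral_eq_lintegral_ofReal (hgi M) (ae_of_all _ fun x => NNReal.coe_nonneg _)]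
      simp [hg]
    simp_rw [← h2] at h1
    exact ENNReal.tendsto_ofReal_nhds_top.1 h1
  filter_upwards [ae_all_iff.2 fun M => ae_tendsto_birkhoffSum_div hS (hgm M) (hgi M)] with x hx
  refine tendsto_atTop.2 fun b => ?_
  obtain ⟨M, hM⟩ := (hlim.eventually_gt_atTop b).exists
  filter_upwards [(hx M).eventually_const_lt hM] with n hn
  refine hn.le.trans ?_
  gcongr
  refine Finset.sum_le_sum fun k _ => ?_
  simp [hg]

end Birkhoff

/-! ### The environment seen from the walk -/

section System

/-- Translation of an environment by `z`. -/
def translate (z : ℤ) (w : ℤ → ℝ≥0) : ℤ → ℝ≥0 := fun x => w (x + z)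

lemma measurable_translate (z : ℤ) : Measurable (translate z) :=
  measurable_pi_iff.2 fun x => measurable_pi_apply (x + z)

lemma measurable_translate_uncurry :
    Measurable fun p : ℤ × (ℤ → ℝ≥0) => translate p.1 p.2 :=
  measurable_from_prod_countable_right fun z => measurable_translate z

lemma translate_translate (y z : ℤ) (w : ℤ → ℝ≥0) :
    translate y (translate z w) = translate (z + y) w := by
  ext x
  simp [translate, add_assoc, add_comm y z]

lemma measurePreserving_translate {ρ : Measure (ℤ → ℝ≥0)} (hρ : MeasurePreserving shift ρ ρ)
    (z : ℤ) : MeasurePreserving (translate z) ρ ρ := by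
  have hnat (n : ℕ) : MeasurePreserving (translate n) ρ ρ := by
    have : translate n = shift^[n] := by
      induction n with
      | zero => ext; simp [translate]
      | succ n ih =>
        rw [Function.iterate_succ', ← ih]
        ext w x
        simp only [translate, shift, Function.comp_apply]
        congr 2
        push_cast
        ring
    rw [this]
    exact hρ.iterate n
  obtain ⟨n, rfl | rfl⟩ := z.eq_nat_or_neg
  · exact hnat n
  · refine ⟨measurable_translate _, ?_⟩
    -- Writing `ρ` as its own image under translation by `n` lets translation by `-n` cancel it.
    conv_lhs => rw [← (hnat n).map_eq]
    rw [Measure.map_map (measurable_translate _) (measurable_translate _)]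
    have : translate (-n) ∘ translate n = id := by
      ext w x
      simp [translate]
    rw [this, Measure.map_id]

variable {B : Type*}

/-- The walk with steps `s (η 0), s (η 1), …`. -/
def pathSum (s : B → ℤ) (n : ℕ) (η : ℕ → B) : ℤ := ∑ k ∈ Finset.range n, s (η k)

/-- The environment seen from the walk, together with the future of the driving sequence. -/
def envStep (s : B → ℤ) (p : (ℕ → B) × (ℤ → ℝ≥0)) : (ℕ → B) × (ℤ → ℝ≥0) :=
  (fun k => p.1 (k + 1), translate (s (p.1 0)) p.2)

/-- The sequence `a 0, …, a (n - 1), η 0, η 1, …`. -/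
def splice (n : ℕ) (a η : ℕ → B) : ℕ → B := fun k => if k < n then a k else η (k - n)

lemma iterate_envStep (s : B → ℤ) (n : ℕ) (p : (ℕ → B) × (ℤ → ℝ≥0)) :
    (envStep s)^[n] p = (fun k => p.1 (k + n), translate (pathSum s n p.1) p.2) := by
  induction n with
  | zero => ext <;> simp [pathSum, translate]
  | succ n ih =>
    rw [Function.iterate_succ_apply', ih, envStep]
    ext1
    · ext k
      simp only [add_assoc, add_comm 1]
    · simp only [translate_translate, pathSum, Finset.sum_range_succ, zero_add]

lemma pathSum_congr (s : B → ℤ) {n : ℕ} {η η' : ℕ → B} (h : ∀ k < n, η k = η' k) :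
    pathSum s n η = pathSum s n η' :=
  Finset.sum_congr rfl fun k hk => by rw [h k (Finset.mem_range.1 hk)]

/-- Pathwise form of the Markov property: `n` steps consume `a`, which acts only through its
displacement, and leave `η` untouched. -/
lemma iterate_envStep_splice (s : B → ℤ) (n : ℕ) (a η : ℕ → B) (w : ℤ → ℝ≥0) :
    (envStep s)^[n] (splice n a η, w) = (η, translate (pathSum s n a) w) := by
  rw [iterate_envStep]
  ext1
  · ext k
    simp [splice]
  · rw [pathSum_congr s (η' := a) fun k hk => by simp [splice, hk]]

variable [MeasurableSpace B] {s : B → ℤ}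

lemma measurable_pathSum (hs : Measurable s) (n : ℕ) : Measurable (pathSum s n) := by
  unfold pathSum
  fun_prop

lemma measurable_envStep (hs : Measurable s) : Measurable (envStep s) := by
  refine Measurable.prodMk (by fun_prop) ?_
  have : Measurable fun p : (ℕ → B) × (ℤ → ℝ≥0) => (s (p.1 0), p.2) := by fun_prop
  exact measurable_translate_uncurry.comp this

lemma measurable_splice (n : ℕ) :
    Measurable fun p : (ℕ → B) × (ℕ → B) => splice n p.1 p.2 := by
  refine measurable_pi_iff.2 fun k => ?_
  by_cases hk : k < n
  · simp only [splice, hk, if_true]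
    fun_prop
  · simp only [splice, hk, if_false]
    fun_prop

lemma measurable_translate_pathSum (hs : Measurable s) (n : ℕ) :
    Measurable fun p : (ℕ → B) × (ℤ → ℝ≥0) => translate (pathSum s n p.1) p.2 :=
  measurable_translate_uncurry.comp
    (((measurable_pathSum hs n).comp measurable_fst).prodMk measurable_snd)

variable (β : Measure B) [IsProbabilityMeasure β]

/-- The law of an i.i.d. sequence with common law `β`. -/
abbrev iidLaw : Measure (ℕ → B) := Measure.infinitePi fun _ : ℕ => β

lemma measurePreserving_splice (n : ℕ) :
    MeasurePreserving (fun p : (ℕ → B) × (ℕ → B) => splice n p.1 p.2)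
      ((iidLaw β).prod (iidLaw β)) (iidLaw β) := by
  refine ⟨measurable_splice n, Measure.eq_infinitePi _ fun t A hA => ?_⟩
  classical
  rw [Measure.map_apply (measurable_splice n) (.pi t.countable_toSet fun i _ => hA i)]
  -- A box splits into a box for `a` on coordinates below `n` and a box for `η` on the others,
  -- lowered by `n`.
  have : (fun p : (ℕ → B) × (ℕ → B) => splice n p.1 p.2) ⁻¹' (Set.pi t A) =
      (Set.pi (t.filter (· < n)) A) ×ˢ
        (Set.pi ((t.filter (¬ · < n)).image (· - n)) fun k => A (k + n)) := by
    ext ⟨a, η⟩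
    simp only [Set.mem_preimage, Set.mem_pi, Finset.mem_coe, Set.mem_prod, Finset.mem_filter,
      Finset.mem_image, splice]
    constructor
    · refine fun h => ⟨fun i hi => by simpa [hi.2] using h i hi.1, ?_⟩
      rintro _ ⟨j, hj, rfl⟩
      have := h j hj.1
      rw [if_neg hj.2] at this
      rwa [Nat.sub_add_cancel (by omega)]
    · rintro ⟨h1, h2⟩ i hi
      split_ifs with hin
      · exact h1 i ⟨hi, hin⟩
      · have := h2 (i - n) ⟨i, ⟨hi, hin⟩, rfl⟩
        rwa [Nat.sub_add_cancel (by omega)] at this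
  rw [this, Measure.prod_prod, Measure.infinitePi_pi _ fun i _ => hA i,
    Measure.infinitePi_pi _ fun i _ => hA _, Finset.prod_image,
    ← Finset.prod_filter_mul_prod_filter_not t (· < n)]
  · congr 1
    refine Finset.prod_congr rfl fun i hi => ?_
    rw [Nat.sub_add_cancel]
    simpa using (Finset.mem_filter.1 hi).2
  · intro i hi j hj h
    simp only [Finset.coe_filter, Set.mem_ofPred_eq] at hi hj
    simp only at h
    omega

variable (ρ : Measure (ℤ → ℝ≥0)) [IsProbabilityMeasure ρ]

/-- Resampling the terms from index `n` on does not change the law; the inner integral is the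
conditional mean given the environment and the first `n` terms. -/
lemma lintegral_splice (n : ℕ) {f : (ℕ → B) × (ℤ → ℝ≥0) → ℝ≥0∞} (hf : Measurable f) :
    ∫⁻ p, f p ∂(iidLaw β).prod ρ =
      ∫⁻ p, ∫⁻ η, f (splice n p.1 η, p.2) ∂iidLaw β ∂(iidLaw β).prod ρ := by
  have h1 : Measurable fun q : ((ℕ → B) × (ℤ → ℝ≥0)) × (ℕ → B) =>
      f (splice n q.1.1 q.2, q.1.2) := by
    have : Measurable fun q : ((ℕ → B) × (ℤ → ℝ≥0)) × (ℕ → B) => splice n q.1.1 q.2 :=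
      (measurable_splice n).comp (measurable_fst.fst.prodMk measurable_snd)
    fun_prop
  have hn := measurable_splice (B := B) n
  rw [lintegral_prod_symm' _ hf, lintegral_prod_symm' _ h1.lintegral_prod_right']
  refine lintegral_congr fun w => ?_
  rw [← (measurePreserving_splice β n).map_eq, lintegral_map (by fun_prop) hn,
    lintegral_prod _ (by fun_prop), (measurePreserving_splice β n).map_eq]

variable {ρ}

/-- The walk is independent of the environment, so its displacement can be frozen; every fixed
translation preserves `ρ`. -/
lemma lintegral_translate_pathSum (hs : Measurable s) (hρ : MeasurePreserving shift ρ ρ) (n : ℕ)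
    {f : (ℤ → ℝ≥0) → ℝ≥0∞} (hf : Measurable f) :
    ∫⁻ p, f (translate (pathSum s n p.1) p.2) ∂(iidLaw β).prod ρ = ∫⁻ w, f w ∂ρ := by
  have hm : Measurable fun p : (ℕ → B) × (ℤ → ℝ≥0) => f (translate (pathSum s n p.1) p.2) :=
    hf.comp (measurable_translate_pathSum hs n)
  rw [lintegral_prod _ hm.aemeasurable]
  have (η : ℕ → B) : ∫⁻ w, f (translate (pathSum s n η) w) ∂ρ = ∫⁻ w, f w ∂ρ :=
    (measurePreserving_translate hρ _).lintegral_comp hf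
  simp [this]

lemma measurePreserving_envStep (hs : Measurable s) (hρ : MeasurePreserving shift ρ ρ) :
    MeasurePreserving (envStep s) ((iidLaw β).prod ρ) ((iidLaw β).prod ρ) := by
  refine ⟨measurable_envStep hs, ?_⟩
  refine Measure.ext_of_lintegral _ fun f hf => ?_
  rw [lintegral_map hf (measurable_envStep hs),
    lintegral_splice β ρ 1 (f := fun p => f (envStep s p)) (hf.comp (measurable_envStep hs))]
  have (p : (ℕ → B) × (ℤ → ℝ≥0)) (η : ℕ → B) :
      f (envStep s (splice 1 p.1 η, p.2)) = f (η, translate (pathSum s 1 p.1) p.2) := by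
    rw [← iterate_envStep_splice s 1, Function.iterate_one]
  simp only [this]
  rw [lintegral_translate_pathSum β hs hρ 1 (f := fun w => ∫⁻ η, f (η, w) ∂iidLaw β)
    hf.lintegral_prod_left', lintegral_prod_symm' _ hf]

end System

/-! ### Ergodicity of the environment seen from the walk -/

section Ergodicity

variable {B : Type*}

/-- The initial segment of length `n` of a sequence, continued by a constant. -/
def truncate (b : B) (n : ℕ) (η : ℕ → B) : ℕ → B := fun k => if k < n then η k else b

lemma truncate_splice (b : B) (n : ℕ) (a η : ℕ → B) :
    truncate b n (splice n a η) = truncate b n a := by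
  ext k
  simp only [truncate, splice]
  split_ifs <;> rfl

lemma truncate_truncate (b : B) {m n : ℕ} (h : m ≤ n) (η : ℕ → B) :
    truncate b m (truncate b n η) = truncate b m η := by
  ext k
  simp only [truncate]
  split_ifs <;> first | rfl | omega

lemma mem_splice_iff {s : B → ℤ} {A : Set ((ℕ → B) × (ℤ → ℝ≥0))} (hinv : envStep s ⁻¹' A = A) (n : ℕ)
    (a η : ℕ → B) (w : ℤ → ℝ≥0) :
    (splice n a η, w) ∈ A ↔ (η, translate (pathSum s n a) w) ∈ A := by
  have h : (envStep s)^[n] ⁻¹' A = A := by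
    rw [Set.preimage_iterate_eq]
    exact Function.iterate_fixed hinv n
  rw [← iterate_envStep_splice s n a η w]
  exact (Set.ext_iff.1 h _).symm

variable [MeasurableSpace B]

lemma measurable_truncate (b : B) (n : ℕ) : Measurable (truncate b n) := by
  refine measurable_pi_iff.2 fun k => ?_
  by_cases hk : k < n
  · simp only [truncate, hk, if_true]
    fun_prop
  · simp only [truncate, hk, if_false]
    fun_prop

/-- The environment and the first `n` terms of the driving sequence. -/
def observe (b : B) (n : ℕ) (p : (ℕ → B) × (ℤ → ℝ≥0)) : (ℕ → B) × (ℤ → ℝ≥0) :=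
  (truncate b n p.1, p.2)

lemma measurable_observe (b : B) (n : ℕ) : Measurable (observe b n) :=
  ((measurable_truncate b n).comp measurable_fst).prodMk measurable_snd

/-- The filtration generated by the environment and the driving sequence. -/
def observeFiltration (b : B) :
    Filtration ℕ (inferInstance : MeasurableSpace ((ℕ → B) × (ℤ → ℝ≥0))) where
  seq n := MeasurableSpace.comap (observe b n) inferInstance
  mono' m n h := by
    have : observe b m = observe b m ∘ observe b n := by
      ext1 p
      simp [observe, truncate_truncate b h]
    simp only
    rw [this, ← MeasurableSpace.comap_comp]
    exact MeasurableSpace.comap_mono (measurable_observe b m).comap_le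
  le' n := (measurable_observe b n).comap_le

lemma iSup_observeFiltration (b : B) :
    ⨆ n, observeFiltration b n = (inferInstance : MeasurableSpace ((ℕ → B) × (ℤ → ℝ≥0))) := by
  refine le_antisymm (iSup_le fun n => (observeFiltration b).le n) ?_
  have hobs (n : ℕ) : Measurable[⨆ n, observeFiltration b n] (observe b n) :=
    Measurable.mono (comap_measurable _) (le_iSup (observeFiltration b) n) le_rfl
  have hid : Measurable[⨆ n, observeFiltration b n]
      (fun p : (ℕ → B) × (ℤ → ℝ≥0) => (p.1, p.2)) := by
    refine Measurable.prodMk ?_ ?_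
    · refine @measurable_pi_lambda _ _ _ (⨆ n, observeFiltration b n) _ _ fun k => ?_
      have h := (measurable_pi_apply k).comp (measurable_fst.comp (hobs (k + 1)))
      have e : ((fun η : ℕ → B => η k) ∘ Prod.fst ∘ observe b (k + 1) :
          (ℕ → B) × (ℤ → ℝ≥0) → B) = fun p => p.1 k := by
        ext p
        simp [observe, truncate]
      rwa [e] at h
    · exact (measurable_snd.comp (hobs 0) :)
  intro A hA
  exact hid hA

variable {s : B → ℤ} (β : Measure B) [IsProbabilityMeasure β]

/-- The conditional probability of an event given the environment. -/
def envProb (A : Set ((ℕ → B) × (ℤ → ℝ≥0))) (w : ℤ → ℝ≥0) : ℝ≥0∞ :=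
  iidLaw β ((fun η => (η, w)) ⁻¹' A)

lemma measurable_envProb {A : Set ((ℕ → B) × (ℤ → ℝ≥0))} (hA : MeasurableSet A) :
    Measurable (envProb β A) := measurable_measure_prodMk_right hA

lemma envProb_le_one (A : Set ((ℕ → B) × (ℤ → ℝ≥0))) (w : ℤ → ℝ≥0) : envProb β A w ≤ 1 :=
  prob_le_one

/-- Conditioning on the first term: for an invariant event the conditional probability is a harmonic
function of the environment. -/
lemma envProb_eq_lintegral {A : Set ((ℕ → B) × (ℤ → ℝ≥0))} (hA : MeasurableSet A)
    (hinv : envStep s ⁻¹' A = A) (hs : Measurable s) (w : ℤ → ℝ≥0) :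
    envProb β A w = ∫⁻ b, envProb β A (translate (s b) w) ∂β := by
  have h1 : MeasurableSet ((fun η : ℕ → B => (η, w)) ⁻¹' A) := hA.preimage (by fun_prop)
  have h2 : Measurable fun b => envProb β A (translate (s b) w) :=
    (measurable_envProb β hA).comp
      (measurable_translate_uncurry.comp (hs.prodMk measurable_const))
  rw [envProb, ← (measurePreserving_splice β 1).map_eq,
    Measure.map_apply (measurable_splice 1) h1,
    Measure.prod_apply (h1.preimage (measurable_splice 1)),
    ← (measurePreserving_eval_infinitePi (fun _ : ℕ => β) 0).lintegral_comp h2]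
  refine lintegral_congr fun a => congrArg _ ?_
  ext η
  simp only [Set.mem_preimage, mem_splice_iff hinv, pathSum, Finset.sum_range_one,
    Function.eval]

/-- Resample the future: `observe b n` does not see it, so the constraint `D` leaves the inner
integral, and what remains there is the probability of `A` after `n` steps. -/
lemma setLIntegral_envProb {A : Set ((ℕ → B) × (ℤ → ℝ≥0))} (hA : MeasurableSet A)
    (hinv : envStep s ⁻¹' A = A) (ρ : Measure (ℤ → ℝ≥0))
    [IsProbabilityMeasure ρ] (b : B) (n : ℕ) {D : Set ((ℕ → B) × (ℤ → ℝ≥0))}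
    (hD : MeasurableSet D) :
    ∫⁻ p in observe b n ⁻¹' D, envProb β A (translate (pathSum s n p.1) p.2) ∂(iidLaw β).prod ρ =
      (iidLaw β).prod ρ (A ∩ observe b n ⁻¹' D) := by
  have hD' := (measurable_observe b n) hD
  rw [← lintegral_indicator_one (hA.inter hD'), ← lintegral_indicator hD',
    lintegral_splice β ρ n (measurable_one.indicator (hA.inter hD'))]
  refine lintegral_congr fun p => ?_
  have ho (η : ℕ → B) : (splice n p.1 η, p.2) ∈ observe b n ⁻¹' D ↔ p ∈ observe b n ⁻¹' D := by
    simp [observe, truncate_splice]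
  by_cases hp : p ∈ observe b n ⁻¹' D
  · rw [Set.indicator_of_mem hp, envProb, ← lintegral_indicator_one (hA.preimage (by fun_prop))]
    refine lintegral_congr fun η => ?_
    have h : η ∈ (fun η => (η, translate (pathSum s n p.1) p.2)) ⁻¹' A ↔
        (splice n p.1 η, p.2) ∈ A := (mem_splice_iff hinv n p.1 η p.2).symm
    by_cases hη : (splice n p.1 η, p.2) ∈ A
    · rw [Set.indicator_of_mem (h.2 hη), Set.indicator_of_mem (Set.mem_inter hη ((ho η).2 hp))]
      rfl
    · rw [Set.indicator_of_notMem (mt h.1 hη), Set.indicator_of_notMem fun h' => hη h'.1]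
  · rw [Set.indicator_of_notMem hp]
    simp [Set.indicator, ho, hp]

lemma envProb_ae_eq_condExp {A : Set ((ℕ → B) × (ℤ → ℝ≥0))} (hA : MeasurableSet A)
    (hinv : envStep s ⁻¹' A = A) (hs : Measurable s) (ρ : Measure (ℤ → ℝ≥0))
    [IsProbabilityMeasure ρ] (b : B) (n : ℕ) :
    (fun p => (envProb β A (translate (pathSum s n p.1) p.2)).toReal) =ᵐ[(iidLaw β).prod ρ]
      ((iidLaw β).prod ρ)[A.indicator (fun _ => (1 : ℝ)) | observeFiltration b n] := by
  have hm : Measurable fun p : (ℕ → B) × (ℤ → ℝ≥0) =>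
      envProb β A (translate (pathSum s n p.1) p.2) :=
    (measurable_envProb β hA).comp (measurable_translate_pathSum hs n)
  have hlt (w) : envProb β A w < ∞ := (envProb_le_one β A w).trans_lt ENNReal.one_lt_top
  refine ae_eq_condExp_of_forall_setIntegral_eq ((observeFiltration b).le n)
    ((integrable_const 1).indicator hA) (fun D _ _ => ?_) ?_ ?_
  · refine Integrable.of_bound hm.ennreal_toReal.aestronglyMeasurable 1 (ae_of_all _ fun p => ?_)
    rw [Real.norm_of_nonneg ENNReal.toReal_nonneg]
    exact ENNReal.toReal_le_of_le_ofReal zero_le_one (by simpa using envProb_le_one β A _)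
  · rintro _ ⟨D, hD, rfl⟩ _
    have hD' := (measurable_observe b n) hD
    rw [integral_toReal hm.aemeasurable (ae_of_all _ fun p => hlt _),
      setLIntegral_envProb β hA hinv ρ b n hD, setIntegral_indicator hA]
    simp [Set.inter_comm A, measureReal_def]
  -- The displacement after `n` steps uses only the first `n` terms, so the function factors through
  -- `observe b n`.
  · refine (Measurable.stronglyMeasurable ?_).aestronglyMeasurable
    have e : (fun p : (ℕ → B) × (ℤ → ℝ≥0) =>
        (envProb β A (translate (pathSum s n p.1) p.2)).toReal) =
        (fun p => (envProb β A (translate (pathSum s n p.1) p.2)).toReal) ∘ observe b n := by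
      ext p
      simp only [observe, Function.comp_apply]
      rw [pathSum_congr s (η := truncate b n p.1) (η' := p.1) fun k hk => by simp [truncate, hk]]
    rw [e]
    exact hm.ennreal_toReal.comp (comap_measurable _)

/-- An invariant event is almost surely determined by the environment. -/
lemma ae_envProb_eq_zero_or_one {A : Set ((ℕ → B) × (ℤ → ℝ≥0))} (hA : MeasurableSet A)
    (hinv : envStep s ⁻¹' A = A) (hs : Measurable s) {ρ : Measure (ℤ → ℝ≥0)}
    [IsProbabilityMeasure ρ] (hρ : MeasurePreserving shift ρ ρ) :
    ∀ᵐ w ∂ρ, envProb β A w = 0 ∨ envProb β A w = 1 := by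
  obtain ⟨b⟩ : Nonempty B := nonempty_of_isProbabilityMeasure β
  set Q := (iidLaw β).prod ρ
  set G : (ℕ → B) × (ℤ → ℝ≥0) → ℕ → ℝ≥0∞ := fun p n =>
    envProb β A (translate (pathSum s n p.1) p.2) with hG
  -- Lévy's upward theorem: the conditional probabilities converge to the indicator of `A`.
  have hlim : ∀ᵐ p ∂Q, Tendsto (fun n => (G p n).toReal) atTop
      (𝓝 (A.indicator (fun _ => (1 : ℝ)) p)) := by
    have h1 := tendsto_ae_condExp (μ := Q) (ℱ := observeFiltration b)
      (A.indicator (fun _ => (1 : ℝ)))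
    rw [iSup_observeFiltration, condExp_of_stronglyMeasurable le_rfl
      ((stronglyMeasurable_const).indicator hA) ((integrable_const 1).indicator hA)] at h1
    filter_upwards [h1, ae_all_iff.2 fun n => envProb_ae_eq_condExp β hA hinv hs ρ b n]
      with p h1 h2
    exact h1.congr fun n => (h2 n).symm
  have hlt (w) : envProb β A w < ∞ := (envProb_le_one β A w).trans_lt ENNReal.one_lt_top
  -- On `[0, 1]` this vanishes only at the endpoints. Its mean along `G` tends to `0`, but by
  -- stationarity does not depend on `n`, so it is `0` throughout.
  set φ : ℝ≥0∞ → ℝ≥0∞ := fun u => ENNReal.ofReal (u.toReal * (1 - u.toReal)) with hφ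
  have hφm : Measurable φ := by fun_prop
  have hm n : Measurable fun p => φ (G p n) :=
    hφm.comp ((measurable_envProb β hA).comp (measurable_translate_pathSum hs n))
  have hint : Tendsto (fun n => ∫⁻ p, φ (G p n) ∂Q) atTop (𝓝 (∫⁻ p, 0 ∂Q)) := by
    refine tendsto_lintegral_of_dominated_convergence (fun _ => 1) hm (fun n => ?_) (by simp) ?_
    · refine ae_of_all _ fun p => ?_
      simp only [hφ, ENNReal.ofReal_le_one]
      nlinarith [sq_nonneg ((G p n).toReal - 1)]
    · filter_upwards [hlim] with p hp
      have := ENNReal.tendsto_ofReal (hp.mul ((tendsto_const_nhds (x := (1 : ℝ))).sub hp))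
      convert this using 2
      by_cases h : p ∈ A <;> simp [h]
  simp only [hG, Q] at hint
  simp only [lintegral_translate_pathSum β hs hρ _
    (f := fun w => φ (envProb β A w)) (hφm.comp (measurable_envProb β hA)), lintegral_zero] at hint
  have h0 := tendsto_nhds_unique tendsto_const_nhds hint
  have hm' : Measurable fun w => φ (envProb β A w) := hφm.comp (measurable_envProb β hA)
  rw [lintegral_eq_zero_iff hm'] at h0
  filter_upwards [h0] with w hw
  have h1 : (envProb β A w).toReal ≤ 1 :=
    ENNReal.toReal_le_of_le_ofReal zero_le_one (by simpa using envProb_le_one β A _)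
  have h2 : (envProb β A w).toReal * (1 - (envProb β A w).toReal) ≤ 0 :=
    ENNReal.ofReal_eq_zero.1 hw
  have h3 : (0 : ℝ) ≤ (envProb β A w).toReal := ENNReal.toReal_nonneg
  rcases h3.eq_or_lt with h | h
  · left
    simpa [ENNReal.toReal_eq_zero_iff, (hlt w).ne] using h.symm
  · right
    have : (envProb β A w).toReal = 1 := by nlinarith
    rwa [ENNReal.toReal_eq_one_iff] at this

/-- The environment seen from the walk is ergodic if the environment is. -/
theorem ergodic_envStep (hs : Measurable s) (hpos : β {b | s b = 1} ≠ 0) {ρ : Measure (ℤ → ℝ≥0)}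
    [IsProbabilityMeasure ρ] (hρ : Ergodic shift ρ) :
    Ergodic (envStep s) ((iidLaw β).prod ρ) := by
  refine ⟨measurePreserving_envStep β hs hρ.toMeasurePreserving, ⟨fun A hA hinv => ?_⟩⟩
  have hGm := measurable_envProb β hA
  set D := {w | envProb β A w = 1} with hD
  have hDm : MeasurableSet D := hGm (measurableSet_singleton 1)
  -- Maximum principle: an average of values at most `1` equals `1` only if almost all do, and a
  -- step to the right has positive probability.
  have hsub : D ⊆ shift ⁻¹' D := by
    intro w hw
    have hw1 : envProb β A w = 1 := hw
    rw [envProb_eq_lintegral β hA hinv hs] at hw1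
    have hm : Measurable fun b => envProb β A (translate (s b) w) :=
      hGm.comp (measurable_translate_uncurry.comp (hs.prodMk measurable_const))
    have hae : (fun b => envProb β A (translate (s b) w)) =ᵐ[β] fun _ => 1 :=
      ae_eq_of_ae_le_of_lintegral_le (ae_of_all _ fun b => envProb_le_one β A _)
        (by simp [hw1]) aemeasurable_const (by simp [hw1])
    by_contra hcon
    refine hpos (measure_mono_null (fun b hb => ?_) (ae_iff.1 hae))
    have hb : s b = 1 := hb
    have e : translate 1 w = shift w := rfl
    simp only [hb, e, Set.mem_ofPred_eq]
    exact hcon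
  have hA0 : (iidLaw β).prod ρ A = ∫⁻ w, envProb β A w ∂ρ := Measure.prod_apply_symm hA
  rw [eventuallyConst_set']
  rcases hρ.ae_empty_or_univ_of_ae_le_preimage hDm.nullMeasurableSet hsub.eventuallyLE with h | h
  · left
    rw [ae_eq_empty, hA0, lintegral_eq_zero_iff hGm]
    filter_upwards [ae_envProb_eq_zero_or_one β hA hinv hs hρ.toMeasurePreserving,
      measure_eq_zero_iff_ae_notMem.1 (ae_eq_empty.1 h)] with w h1 h2
    exact h1.resolve_right h2
  · right
    rw [ae_eq_univ, prob_compl_eq_zero_iff hA, hA0]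
    have : envProb β A =ᵐ[ρ] fun _ => 1 := by
      filter_upwards [mem_ae_iff.2 (ae_eq_univ.1 h)] with w hw using hw
    simp [lintegral_congr_ae this]

end Ergodicity

/-! ### Escape probability and drift -/

section Escape

variable {B : Type*} {s : B → ℤ}

lemma birkhoffSum_step (s : B → ℤ) (n : ℕ) (p : (ℕ → B) × (ℤ → ℝ≥0)) :
    birkhoffSum (envStep s) (fun p => (s (p.1 0) : ℝ)) n p = pathSum s n p.1 := by
  simp [birkhoffSum, iterate_envStep, pathSum]

lemma birkhoffSum_neg_step (s : B → ℤ) (n : ℕ) (p : (ℕ → B) × (ℤ → ℝ≥0)) :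
    birkhoffSum (envStep s) (fun p => -(s (p.1 0) : ℝ)) n p = -pathSum s n p.1 := by
  simp [birkhoffSum, iterate_envStep, pathSum]

lemma pathSum_succ' (s : B → ℤ) (n : ℕ) (p : (ℕ → B) × (ℤ → ℝ≥0)) :
    pathSum s (n + 1) p.1 = s (p.1 0) + pathSum s n (envStep s p).1 := by
  simp [pathSum, Finset.sum_range_succ', envStep, add_comm]

/-- The event that the walk is positive at the times `1, …, n + 1`. -/
def staysPositive (s : B → ℤ) (n : ℕ) : Set ((ℕ → B) × (ℤ → ℝ≥0)) :=
  {p | ∀ j ≤ n, 1 ≤ pathSum s (j + 1) p.1}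

/-- The first step minus the maximum at `envStep s p` is the minimum of the walk over times `1, …, n
+ 1`, and the left side is its positive part. This minimum is an integer at most `1`, because the
first step is. -/
lemma step_add_maxSum_sub (hs1 : ∀ b, s b = 1 ∨ s b = -1) (n : ℕ) (p : (ℕ → B) × (ℤ → ℝ≥0)) :
    (s (p.1 0) : ℝ) + (maxSum (envStep s) (fun p => -(s (p.1 0) : ℝ)) (n + 1) p -
      maxSum (envStep s) (fun p => -(s (p.1 0) : ℝ)) n (envStep s p)) =
    (staysPositive s n).indicator 1 p := by
  rw [maxSum_succ_sub_comp]
  set M := maxSum (envStep s) (fun p => -(s (p.1 0) : ℝ)) n (envStep s p) with hM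
  have hM0 : 0 ≤ M := maxSum_nonneg _ _ _ _
  by_cases hp : p ∈ staysPositive s n
  · rw [Set.indicator_of_mem hp, Pi.one_apply]
    obtain ⟨k, hk, e⟩ := exists_birkhoffSum_eq_maxSum (envStep s)
      (fun p => -(s (p.1 0) : ℝ)) n (envStep s p)
    rw [birkhoffSum_neg_step, ← hM] at e
    have h1 : (1 : ℝ) ≤ pathSum s (k + 1) p.1 := by exact_mod_cast hp k hk
    rw [pathSum_succ'] at h1
    push_cast at h1
    have h2 : (s (p.1 0) : ℝ) = 1 := by
      rcases hs1 (p.1 0) with h | h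
      · simp [h]
      · rw [h] at h1
        push_cast at h1
        linarith
    rw [h2] at h1 ⊢
    rw [max_eq_left] <;> linarith
  · rw [Set.indicator_of_notMem hp]
    simp only [staysPositive, Set.mem_ofPred_eq, not_forall, not_le] at hp
    obtain ⟨j, hj, h⟩ := hp
    rw [pathSum_succ'] at h
    have h1 : (s (p.1 0) : ℝ) + pathSum s j (envStep s p).1 ≤ 0 := by
      exact_mod_cast Int.lt_add_one_iff.1 h
    have h2 := birkhoffSum_le_maxSum (envStep s) (fun p => -(s (p.1 0) : ℝ)) hj (envStep s p)
    rw [birkhoffSum_neg_step, ← hM] at h2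
    rw [max_eq_right] <;> linarith

lemma iInter_staysPositive_iff (hs1 : ∀ b, s b = 1 ∨ s b = -1) {p : (ℕ → B) × (ℤ → ℝ≥0)}
    (hp : ∀ᶠ n in atTop, 0 < pathSum s n p.1) :
    (∀ n, p ∈ staysPositive s n) ↔ ∀ n, 1 ≤ n → pathSum s n p.1 ≠ 0 := by
  constructor
  · intro h n hn
    have := h n (n - 1) (by omega)
    rw [Nat.sub_add_cancel hn] at this
    omega
  intro h
  have hstep (j : ℕ) : pathSum s (j + 1) p.1 = pathSum s j p.1 + s (p.1 j) :=
    Finset.sum_range_succ _ _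
  have key : ∀ j, 1 ≤ pathSum s (j + 1) p.1 := by
    by_contra! hcon
    obtain ⟨i, hi⟩ := hcon
    -- Unit steps cannot cross zero without visiting it, so a nonpositive value at a positive time
    -- traps the walk below zero.
    have hneg : ∀ j ≥ i, pathSum s (j + 1) p.1 ≤ 0 := by
      intro j hj
      induction j, hj using Nat.le_induction with
      | base => omega
      | succ j hj ih =>
        have h1 := h (j + 1) (by omega)
        have h2 := hstep (j + 1)
        rcases hs1 (p.1 (j + 1)) with h3 | h3 <;> omega
    obtain ⟨N, hN⟩ := eventually_atTop.1 hp
    have h1 := hN (max N i + 1) (by omega)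
    have h2 := hneg (max N i) (by omega)
    omega
  exact fun n j _ => key j

lemma norm_step_le (hs1 : ∀ b, s b = 1 ∨ s b = -1) (b : B) : ‖(s b : ℝ)‖ ≤ 1 := by
  rcases hs1 b with h | h <;> simp [h]

variable [MeasurableSpace B] (β : Measure B) [IsProbabilityMeasure β]
  {ρ : Measure (ℤ → ℝ≥0)} [IsProbabilityMeasure ρ]

lemma measurableSet_staysPositive (hs : Measurable s) (n : ℕ) :
    MeasurableSet (staysPositive s n) := by
  simp only [staysPositive, Set.ofPred_forall]
  exact .iInter fun j => .iInter fun _ =>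
    measurableSet_le measurable_const ((measurable_pathSum hs _).comp measurable_fst)

lemma measurable_step (hs : Measurable s) :
    Measurable fun p : (ℕ → B) × (ℤ → ℝ≥0) => (s (p.1 0) : ℝ) := by
  have : Measurable fun z : ℤ => (z : ℝ) := measurable_of_countable _
  fun_prop

lemma integrable_step (hs : Measurable s) (hs1 : ∀ b, s b = 1 ∨ s b = -1) :
    Integrable (fun p : (ℕ → B) × (ℤ → ℝ≥0) => (s (p.1 0) : ℝ)) ((iidLaw β).prod ρ) :=
  .of_bound (measurable_step hs).aestronglyMeasurable 1 (ae_of_all _ fun _ => norm_step_le hs1 _)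

lemma integral_step (hs : Measurable s) :
    ∫ p : (ℕ → B) × (ℤ → ℝ≥0), (s (p.1 0) : ℝ) ∂(iidLaw β).prod ρ = ∫ b, (s b : ℝ) ∂β := by
  have hz : Measurable fun z : ℤ => (z : ℝ) := measurable_of_countable _
  have h := (measurePreserving_eval_infinitePi (fun _ : ℕ => β) 0).comp
    (measurePreserving_fst (μ := iidLaw β) (ν := ρ))
  have hi := integral_map (f := fun b => (s b : ℝ)) h.aemeasurable
    (hz.comp hs).aestronglyMeasurable
  rw [h.map_eq] at hi
  exact hi.symm

lemma ae_tendsto_pathSum_div (hs : Measurable s) (hs1 : ∀ b, s b = 1 ∨ s b = -1)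
    (hpos : β {b | s b = 1} ≠ 0) (hρ : Ergodic shift ρ) :
    ∀ᵐ p ∂(iidLaw β).prod ρ, Tendsto (fun n : ℕ => (pathSum s n p.1 : ℝ) / n) atTop
      (𝓝 (∫ b, (s b : ℝ) ∂β)) := by
  have := ae_tendsto_birkhoffSum_div (ergodic_envStep β hs hpos hρ) (measurable_step hs)
    (integrable_step β hs hs1)
  simpa only [birkhoffSum_step, integral_step β hs] using this

/-- The escape probability of a nearest-neighbour walk with positive drift is its drift. -/
theorem measure_forall_pathSum_ne_zero (hs : Measurable s) (hs1 : ∀ b, s b = 1 ∨ s b = -1)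
    (hpos : β {b | s b = 1} ≠ 0) (hρ : Ergodic shift ρ) (hv : 0 < ∫ b, (s b : ℝ) ∂β) :
    (iidLaw β).prod ρ {p | ∀ n, 1 ≤ n → pathSum s n p.1 ≠ 0} =
      ENNReal.ofReal (∫ b, (s b : ℝ) ∂β) := by
  set Q := (iidLaw β).prod ρ with hQ
  set f : (ℕ → B) × (ℤ → ℝ≥0) → ℝ := fun p => -(s (p.1 0) : ℝ) with hf
  have hS := ergodic_envStep β hs hpos hρ
  have hfm : Measurable f := (measurable_step hs).neg
  have hfi : Integrable f Q := (integrable_step β hs hs1).neg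
  have hM n := measurable_maxSum hS.measurable hfm n
  have hMi n := integrable_maxSum hS.toMeasurePreserving hfi n
  have hbdd : ∀ᵐ p ∂Q, ∃ C : ℕ, ∀ n, maxSum (envStep s) f n p ≤ C := by
    refine ae_bddAbove_maxSum hS hfm hfi ?_
    rw [integral_neg, integral_step β hs]
    linarith
  -- Bounded increasing sequences have increments tending to `0`; here the increments lie in `[0,
  -- 1]`.
  have hlim : Tendsto (fun n => ∫ p, (maxSum (envStep s) f (n + 1) p - maxSum (envStep s) f n p) ∂Q)
      atTop (𝓝 (∫ p, 0 ∂Q)) := by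
    refine tendsto_integral_of_dominated_convergence (fun _ => 1)
      (fun n => ((hM _).sub (hM _)).aestronglyMeasurable) (integrable_const _)
      (fun n => ae_of_all _ fun p => ?_) ?_
    · rw [Real.norm_of_nonneg (sub_nonneg.2 (maxSum_le_succ _ _ _ _))]
      refine maxSum_succ_sub_le _ _ (fun p => ?_) _ _
      exact (neg_le_abs _).trans (norm_step_le hs1 _)
    · filter_upwards [hbdd] with p ⟨C, hC⟩
      have h := tendsto_atTop_ciSup (monotone_maxSum (envStep s) f p)
        ⟨C, by rintro _ ⟨n, rfl⟩; exact hC n⟩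
      simpa using (h.comp (tendsto_add_atTop_nat 1)).sub h
  have hprob (n : ℕ) : Q.real (staysPositive s n) = ∫ b, (s b : ℝ) ∂β +
      ∫ p, (maxSum (envStep s) f (n + 1) p - maxSum (envStep s) f n p) ∂Q := by
    rw [← integral_indicator_one (measurableSet_staysPositive hs n)]
    simp only [← step_add_maxSum_sub hs1]
    have hi : Integrable (fun p => maxSum (envStep s) f (n + 1) p -
        maxSum (envStep s) f n (envStep s p)) Q :=
      (hMi _).sub (hS.toMeasurePreserving.integrable_comp_of_integrable (hMi n))
    rw [integral_add (integrable_step β hs hs1) hi,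
      integral_step β hs, integral_maxSum_succ_sub_comp hS.toMeasurePreserving hfm hfi]
  have hanti : Antitone (staysPositive s) := fun m n h p hp j hj => hp j (hj.trans h)
  have h1 := tendsto_measure_iInter_atTop (μ := Q)
    (fun n => (measurableSet_staysPositive hs n).nullMeasurableSet) hanti ⟨0, measure_ne_top _ _⟩
  have h2 : Tendsto (fun n => Q (staysPositive s n)) atTop
      (𝓝 (ENNReal.ofReal (∫ b, (s b : ℝ) ∂β))) := by
    have e (n) : Q (staysPositive s n) = ENNReal.ofReal (Q.real (staysPositive s n)) := by simp
    simp only [e, hprob]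
    refine ENNReal.tendsto_ofReal ?_
    simpa using hlim.const_add (∫ b, (s b : ℝ) ∂β)
  rw [← tendsto_nhds_unique h1 h2]
  -- Positive drift makes the walk eventually positive, so never returning to zero and always
  -- staying positive agree almost surely.
  refine measure_congr (eventuallyEq_set.2 ?_)
  filter_upwards [ae_tendsto_pathSum_div β hs hs1 hpos hρ] with p hp
  simp only [Set.mem_iInter]
  refine (iInter_staysPositive_iff hs1 ?_).symm
  filter_upwards [hp.eventually_const_lt hv] with n hn
  by_contra! hcon
  refine hn.not_ge (div_nonpos_of_nonpos_of_nonneg ?_ (Nat.cast_nonneg n))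
  exact_mod_cast hcon

end Escape

/-! ### The i.i.d. sequence read along the walk -/

section Law

variable {D : Type*} [MeasurableSpace D]

/-- The sequence of the steps `x k`, together with the values of `θ` that the walk with these steps
uses at the times `k`. -/
def pairAlong (q : (ℕ → ℤ) × (ℤ → ℕ → D)) : ℕ → ℤ × D :=
  fun k => (q.1 k, q.2 (∑ i ∈ Finset.range k, q.1 i) k)

lemma measurable_pairAlong : Measurable (pairAlong (D := D)) := by
  refine measurable_pi_iff.2 fun k => Measurable.prodMk (by fun_prop) ?_
  have h : Measurable fun r : ℤ × (ℤ → ℕ → D) => r.2 r.1 k :=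
    measurable_from_prod_countable_right fun z => by fun_prop
  have h' : Measurable fun q : (ℕ → ℤ) × (ℤ → ℕ → D) =>
      ((∑ i ∈ Finset.range k, q.1 i), q.2) := by fun_prop
  exact h.comp h'

/-- Along a walk with independent steps, an independent field of i.i.d. variables indexed by space
and time is seen as an i.i.d. sequence, independent of the steps. -/
lemma map_pairAlong {ξlaw : Measure ℤ} [IsProbabilityMeasure ξlaw] {ν : Measure D}
    [IsProbabilityMeasure ν] {μτ : Measure (ℤ → ℕ → D)}
    (hτ : μτ.map (fun θ (i : ℤ × ℕ) => θ i.1 i.2) = Measure.infinitePi fun _ => ν) :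
    ((iidLaw ξlaw).prod μτ).map pairAlong = iidLaw (ξlaw.prod ν) := by
  have hm : Measurable fun (θ : ℤ → ℕ → D) (i : ℤ × ℕ) => θ i.1 i.2 := by fun_prop
  have : IsProbabilityMeasure μτ := by
    refine ⟨?_⟩
    rw [← Set.preimage_univ (f := fun (θ : ℤ → ℕ → D) (i : ℤ × ℕ) => θ i.1 i.2),
      ← Measure.map_apply hm .univ, hτ, measure_univ]
  refine Measure.eq_infinitePi _ fun t A hA => ?_
  have hB : MeasurableSet (Set.pi t A) := .pi t.countable_toSet fun i _ => hA i
  rw [Measure.map_apply measurable_pairAlong hB,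
    Measure.prod_apply (measurable_pairAlong hB)]
  -- For frozen steps the space-time indices visited are distinct, since their time coordinates are,
  -- so the values read there are i.i.d. with law `ν`.
  have hsec (x : ℕ → ℤ) : μτ (Prod.mk x ⁻¹' (pairAlong ⁻¹' Set.pi t A)) =
      ∏ k ∈ t, ν (Prod.mk (x k) ⁻¹' A k) := by
    have hinj : Function.Injective fun k : ℕ => (∑ i ∈ Finset.range k, x i, k) :=
      fun k l h => (Prod.ext_iff.1 h).2
    have hlaw := Measure.map_infinitePi_infinitePi_of_inj (P := fun _ : ℤ × ℕ => ν) hinj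
    rw [← hτ, Measure.map_map (by fun_prop) hm] at hlaw
    have hC (k : ℕ) : MeasurableSet (Prod.mk (x k) ⁻¹' A k) := measurable_prodMk_left (hA k)
    rw [← Measure.infinitePi_pi (fun _ => ν) fun k _ => hC k, ← hlaw,
      Measure.map_apply (by fun_prop) (.pi t.countable_toSet fun i _ => hC i)]
    rfl
  simp only [hsec, Measure.prod_apply (hA _)]
  have hmA (k : ℕ) : Measurable fun z : ℤ => ν (Prod.mk z ⁻¹' A k) := measurable_of_countable _
  have hind := iIndepFun_infinitePi (P := fun _ : ℕ => ξlaw) (X := fun k z => ν (Prod.mk z ⁻¹' A k))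
    hmA
  rw [lintegral_prod_eq_prod_lintegral_of_indepFun t _ hind fun k =>
    (hmA k).comp (measurable_pi_apply k)]
  refine Finset.prod_congr rfl fun k _ => ?_
  exact (measurePreserving_eval_infinitePi (fun _ : ℕ => ξlaw) k).lintegral_comp (hmA k)

end Law

/-! ### Measurable evaluation of càdlàg paths -/

section Evaluation

/-- The least multiple of `1 / (n + 1)` that is larger than `r`. -/
def rightApprox (r : ℝ≥0) (n : ℕ) : ℝ≥0 := (⌊((n : ℝ≥0) + 1) * r⌋₊ + 1) / ((n : ℝ≥0) + 1)

lemma le_rightApprox (r : ℝ≥0) (n : ℕ) : r ≤ rightApprox r n := by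
  rw [rightApprox, le_div_iff₀ (by positivity), mul_comm]
  exact (Nat.lt_floor_add_one _).le

lemma rightApprox_le (r : ℝ≥0) (n : ℕ) : rightApprox r n ≤ r + 1 / ((n : ℝ≥0) + 1) := by
  rw [rightApprox, add_div]
  gcongr
  rw [div_le_iff₀ (by positivity), mul_comm r]
  exact Nat.floor_le zero_le

lemma tendsto_rightApprox (r : ℝ≥0) : Tendsto (rightApprox r) atTop (𝓝[≥] r) := by
  refine tendsto_nhdsWithin_iff.2 ⟨?_, Eventually.of_forall (le_rightApprox r)⟩
  refine tendsto_of_tendsto_of_tendsto_of_le_of_le tendsto_const_nhds ?_ (le_rightApprox r)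
    (rightApprox_le r)
  simpa using (tendsto_one_div_add_atTop_nhds_zero_nat (𝕜 := ℝ≥0)).const_add r

/-- The right limit of `σ` at `r`, as a jointly measurable function of `σ` and `r`. -/
def evalRight (σ : ℝ≥0 → ℝ≥0) (r : ℝ≥0) : ℝ≥0 :=
  liminf (fun n => σ (rightApprox r n)) atTop

lemma IsCadlag.evalRight_eq {σ : ℝ≥0 → ℝ≥0} (h : IsCadlag σ) (r : ℝ≥0) : evalRight σ r = σ r :=
  ((h.1 r).tendsto.comp (tendsto_rightApprox r)).liminf_eq

/-- For each `n` the evaluation points lie in a countable grid, so each approximant is a countable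
selection of coordinate maps. -/
lemma measurable_evalRight :
    Measurable fun q : (ℝ≥0 → ℝ≥0) × ℝ≥0 => evalRight q.1 q.2 := by
  refine Measurable.liminf fun n => ?_
  have h : Measurable fun r : ℕ × (ℝ≥0 → ℝ≥0) => r.2 ((r.1 + 1) / ((n : ℝ≥0) + 1)) :=
    measurable_from_prod_countable_right fun m =>
      measurable_pi_apply (((m : ℝ≥0) + 1) / ((n : ℝ≥0) + 1))
  have h' : Measurable fun q : (ℝ≥0 → ℝ≥0) × ℝ≥0 => (⌊((n : ℝ≥0) + 1) * q.2⌋₊, q.1) := by fun_prop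
  exact h.comp h'

end Evaluation

/-! ### From jump times to continuous time -/

section Deterministic

lemma existsUnique_mem_interval {T : ℕ → ℝ≥0} (hT0 : T 0 = 0) (hmono : Monotone T)
    (hT : Tendsto T atTop atTop) (t : ℝ≥0) : ∃! k, T k ≤ t ∧ t < T (k + 1) := by
  classical
  have hex : ∃ n, t < T n := (hT.eventually_gt_atTop t).exists
  have h0 : Nat.find hex ≠ 0 := by
    intro h
    have := Nat.find_spec hex
    rw [h, hT0] at this
    exact not_lt_zero this
  obtain ⟨k, hk⟩ := Nat.exists_eq_succ_of_ne_zero h0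
  refine ⟨k, ⟨not_lt.1 (Nat.find_min hex (by omega)), ?_⟩, ?_⟩
  · have := Nat.find_spec hex
    rwa [hk] at this
  · rintro l ⟨hl1, hl2⟩
    have h1 : Nat.find hex ≤ l + 1 := Nat.find_le hl2
    by_contra hne
    have h2 : Nat.find hex ≤ l := by omega
    exact (Nat.find_spec hex).not_ge ((hmono h2).trans hl1)

/-- Squeeze `κ t / t` between `κ t / T (κ t + 1)` and `κ t / T (κ t)`. The limit `c = 0` is allowed,
which covers infinite mean holding times. -/
lemma tendsto_index_div {T : ℕ → ℝ≥0} (hmono : Monotone T) (hT : Tendsto T atTop atTop)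
    {c : ℝ} (hc : Tendsto (fun n : ℕ => (n : ℝ) / T n) atTop (𝓝 c)) {κ : ℝ≥0 → ℕ}
    (hκ : ∀ t, T (κ t) ≤ t ∧ t < T (κ t + 1)) :
    Tendsto κ atTop atTop ∧ Tendsto (fun t : ℝ≥0 => (κ t : ℝ) / t) atTop (𝓝 c) := by
  have hκT : Tendsto κ atTop atTop := by
    refine tendsto_atTop.2 fun N => ?_
    filter_upwards [eventually_ge_atTop (T N)] with t ht
    by_contra! hlt
    exact ((hκ t).2.trans_le (hmono hlt)).not_ge ht
  refine ⟨hκT, ?_⟩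
  have hlow : Tendsto (fun n : ℕ => (n : ℝ) / T (n + 1)) atTop (𝓝 c) := by
    have h := (hc.comp (tendsto_add_atTop_nat 1)).mul (tendsto_natCast_div_add_atTop (1 : ℝ))
    rw [mul_one] at h
    refine h.congr fun n => ?_
    have : (n : ℝ) + 1 ≠ 0 := by positivity
    simp only [Function.comp_apply]
    push_cast
    field_simp
  refine tendsto_of_tendsto_of_tendsto_of_le_of_le' (hlow.comp hκT) (hc.comp hκT) ?_ ?_
  · filter_upwards [eventually_gt_atTop 0] with t ht
    have h1 : (t : ℝ) ≤ T (κ t + 1) := by exact_mod_cast (hκ t).2.le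
    have h2 : (0 : ℝ) < t := by exact_mod_cast ht
    exact div_le_div_of_nonneg_left (Nat.cast_nonneg _) h2 h1
  · filter_upwards [hκT.eventually (hT.eventually_gt_atTop 0)] with t ht
    have h1 : (T (κ t) : ℝ) ≤ t := by exact_mod_cast (hκ t).1
    have h2 : (0 : ℝ) < T (κ t) := by exact_mod_cast ht
    exact div_le_div_of_nonneg_left (Nat.cast_nonneg _) h2 h1

variable {Ω : Type*} {ξ : Ω → ℕ → ℤ} {w : Ω → ℤ → ℝ≥0} {τ : Ω → ℤ → ℕ → ℝ≥0 → ℝ≥0} {ω : Ω}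

lemma monotone_jumpTime : Monotone fun n => jumpTime ξ w τ n ω :=
  fun _ _ h => Finset.sum_le_sum_of_subset (Finset.range_mono h)

lemma tendsto_position_div (hT : Tendsto (fun n => jumpTime ξ w τ n ω) atTop atTop) {v c : ℝ}
    (hv : Tendsto (fun n : ℕ => (walk ξ n ω : ℝ) / n) atTop (𝓝 v))
    (hc : Tendsto (fun n : ℕ => (n : ℝ) / jumpTime ξ w τ n ω) atTop (𝓝 c)) :
    Tendsto (fun t : ℝ≥0 => (position ξ w τ t ω : ℝ) / (t : ℝ)) atTop (𝓝 (v * c)) := by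
  have hex := existsUnique_mem_interval (by simp [jumpTime]) (monotone_jumpTime (ω := ω)) hT
  choose κ hκ hu using hex
  have hpos (t : ℝ≥0) : position ξ w τ t ω = walk ξ (κ t) ω := by
    classical
    have h : ∃ k, jumpTime ξ w τ k ω ≤ t ∧ t < jumpTime ξ w τ (k + 1) ω := ⟨κ t, hκ t⟩
    rw [position, dif_pos h, hu t _ (Nat.find_spec h)]
  obtain ⟨h1, h2⟩ := tendsto_index_div monotone_jumpTime hT hc hκ
  refine ((hv.comp h1).mul h2).congr' ?_
  filter_upwards [h1.eventually_gt_atTop 0] with t ht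
  have : (κ t : ℝ) ≠ 0 := by exact_mod_cast ht.ne'
  rw [hpos, Function.comp_apply]
  field_simp

end Deterministic

/-! ### Application to the model -/

section Model

/-- The step of the walk encoded by an element of the driving sequence. -/
def signStep (b : ℤ × (ℝ≥0 → ℝ≥0)) : ℤ := if b.1 = 1 then 1 else -1

lemma measurable_signStep : Measurable signStep := by
  have : Measurable fun z : ℤ => if z = 1 then (1 : ℤ) else -1 := measurable_of_countable _
  exact this.comp measurable_fst

/-- Holds for every `b`, not just almost surely: values other than `1` are sent to `-1`, which
changes the model's steps only on a null event. -/
lemma signStep_eq_or (b : ℤ × (ℝ≥0 → ℝ≥0)) : signStep b = 1 ∨ signStep b = -1 := by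
  unfold signStep
  split_ifs <;> simp

/-- The holding time spent in the current site. -/
def currentHold (p : (ℕ → ℤ × (ℝ≥0 → ℝ≥0)) × (ℤ → ℝ≥0)) : ℝ≥0 := evalRight (p.1 0).2 (p.2 0)

lemma measurable_currentHold : Measurable currentHold := by
  have h1 : Measurable fun p : (ℕ → ℤ × (ℝ≥0 → ℝ≥0)) × (ℤ → ℝ≥0) => (p.1 0).2 :=
    measurable_snd.comp ((measurable_pi_apply 0).comp measurable_fst)
  have h2 : Measurable fun p : (ℕ → ℤ × (ℝ≥0 → ℝ≥0)) × (ℤ → ℝ≥0) => p.2 0 :=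
    (measurable_pi_apply 0).comp measurable_snd
  have h := measurable_evalRight.comp (h1.prodMk h2)
  simp only [Function.comp_def] at h
  exact h

lemma birkhoffSum_currentHold (n : ℕ) (p : (ℕ → ℤ × (ℝ≥0 → ℝ≥0)) × (ℤ → ℝ≥0)) :
    birkhoffSum (envStep signStep) currentHold n p =
      ∑ k ∈ Finset.range n, evalRight (p.1 k).2 (p.2 (pathSum signStep k p.1)) := by
  simp [birkhoffSum, iterate_envStep, currentHold, translate]

lemma stepProb_pos (lam : ℝ) : 0 < stepProb lam := by
  unfold stepProb
  positivity

lemma stepProb_le_one (lam : ℝ) : stepProb lam ≤ 1 := by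
  unfold stepProb
  rw [div_le_one (by positivity)]
  linarith [Real.exp_pos (-lam)]

lemma two_mul_stepProb_sub_one (lam : ℝ) : 2 * stepProb lam - 1 = Real.tanh lam := by
  rw [Real.tanh_eq_sinh_div_cosh, Real.sinh_eq, Real.cosh_eq, stepProb]
  have : Real.exp lam + Real.exp (-lam) ≠ 0 := by positivity
  field_simp
  ring

variable {Ω : Type*} [MeasurableSpace Ω] {P : Measure Ω} {lam : ℝ}
  {ξ : Ω → ℕ → ℤ} {w : Ω → ℤ → ℝ≥0} {τ : Ω → ℤ → ℕ → ℝ≥0 → ℝ≥0}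

/-- The driving sequence of the model together with its environment. -/
def driving (ξ : Ω → ℕ → ℤ) (w : Ω → ℤ → ℝ≥0) (τ : Ω → ℤ → ℕ → ℝ≥0 → ℝ≥0) (ω : Ω) :
    (ℕ → ℤ × (ℝ≥0 → ℝ≥0)) × (ℤ → ℝ≥0) := (pairAlong (ξ ω, τ ω), w ω)

/-- The law of the pairs of a step and a holding-time process. -/
def driveLaw (P : Measure Ω) (ξ : Ω → ℕ → ℤ) (τ : Ω → ℤ → ℕ → ℝ≥0 → ℝ≥0) :
    Measure (ℤ × (ℝ≥0 → ℝ≥0)) := (P.map fun ω => ξ ω 0).prod (P.map fun ω => τ ω 0 0)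

namespace IsModel

lemma measurable_driving (h : IsModel P lam ξ w τ) : Measurable (driving ξ w τ) :=
  (measurable_pairAlong.comp (h.measurable_step.prodMk h.measurable_hold)).prodMk h.measurable_env

lemma measurable_step_apply (h : IsModel P lam ξ w τ) (k : ℕ) : Measurable fun ω => ξ ω k :=
  (measurable_pi_apply k).comp h.measurable_step

lemma measurable_hold_apply (h : IsModel P lam ξ w τ) (x : ℤ) (k : ℕ) :
    Measurable fun ω => τ ω x k :=
  (measurable_pi_apply k).comp ((measurable_pi_apply x).comp h.measurable_hold)

variable [IsProbabilityMeasure P]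

lemma isProbabilityMeasure_map_step (h : IsModel P lam ξ w τ) :
    IsProbabilityMeasure (P.map fun ω => ξ ω 0) :=
  Measure.isProbabilityMeasure_map (h.measurable_step_apply 0).aemeasurable

lemma isProbabilityMeasure_map_hold (h : IsModel P lam ξ w τ) :
    IsProbabilityMeasure (P.map fun ω => τ ω 0 0) :=
  Measure.isProbabilityMeasure_map (h.measurable_hold_apply 0 0).aemeasurable

lemma isProbabilityMeasure_map_env (h : IsModel P lam ξ w τ) : IsProbabilityMeasure (P.map w) :=
  Measure.isProbabilityMeasure_map h.measurable_env.aemeasurable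

lemma isProbabilityMeasure_driveLaw (h : IsModel P lam ξ w τ) :
    IsProbabilityMeasure (driveLaw P ξ τ) := by
  have := h.isProbabilityMeasure_map_step
  have := h.isProbabilityMeasure_map_hold
  unfold driveLaw
  infer_instance

lemma ae_step (h : IsModel P lam ξ w τ) : ∀ᵐ ω ∂P, ∀ k, ξ ω k = 1 ∨ ξ ω k = -1 := by
  refine ae_all_iff.2 fun k => ?_
  have hm (z : ℤ) : MeasurableSet {ω | ξ ω k = z} :=
    h.measurable_step_apply k (measurableSet_singleton z)
  have hd : Disjoint {ω | ξ ω k = 1} {ω | ξ ω k = -1} := by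
    refine Set.disjoint_left.2 fun ω h1 h2 => ?_
    have h1 : ξ ω k = 1 := h1
    have h2 : ξ ω k = -1 := h2
    omega
  have h1 : P ({ω | ξ ω k = 1} ∪ {ω | ξ ω k = -1}) = 1 := by
    rw [measure_union hd (hm _), h.step_right, h.step_left,
      ← ENNReal.ofReal_add (stepProb_pos lam).le (sub_nonneg.2 (stepProb_le_one lam))]
    simp
  exact (mem_ae_iff_prob_eq_one ((hm _).union (hm _))).2 h1

lemma map_step (h : IsModel P lam ξ w τ) (k : ℕ) :
    P.map (fun ω => ξ ω k) = P.map (fun ω => ξ ω 0) := by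
  have hsing (k : ℕ) (z : ℤ) : P.map (fun ω => ξ ω k) {z} = P {ω | ξ ω k = z} :=
    Measure.map_apply (h.measurable_step_apply k) (measurableSet_singleton z)
  refine Measure.ext_of_singleton fun z => ?_
  rw [hsing, hsing]
  by_cases h1 : z = 1
  · rw [h1, h.step_right, h.step_right]
  by_cases h2 : z = -1
  · rw [h2, h.step_left, h.step_left]
  have h0 (k : ℕ) : P {ω | ξ ω k = z} = 0 := by
    refine measure_mono_null (fun ω hω => ?_) (ae_iff.1 h.ae_step)
    have hω : ξ ω k = z := hω
    intro hcon
    rcases hcon k with h' | h'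
    · exact h1 (hω.symm.trans h')
    · exact h2 (hω.symm.trans h')
  rw [h0, h0]

lemma map_steps (h : IsModel P lam ξ w τ) : P.map ξ = iidLaw (P.map fun ω => ξ ω 0) := by
  have := h.step_indep.map_fun_eq_infinitePi_map h.measurable_step_apply
  simpa only [h.map_step] using this

omit [IsProbabilityMeasure P] in
lemma map_holds (h : IsModel P lam ξ w τ) :
    (P.map τ).map (fun θ (i : ℤ × ℕ) => θ i.1 i.2) =
      Measure.infinitePi fun _ => P.map fun ω => τ ω 0 0 := by
  have := h.hold_indep.map_fun_eq_infinitePi_map fun i : ℤ × ℕ =>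
    h.measurable_hold_apply i.1 i.2
  rw [Measure.map_map (by fun_prop) h.measurable_hold]
  have e (i : ℤ × ℕ) : P.map (fun ω => τ ω i.1 i.2) = P.map fun ω => τ ω 0 0 :=
    (h.hold_identDistrib i (0, 0)).map_eq
  simp only [e] at this
  exact this

/-- The driving sequence is i.i.d. and independent of the environment. -/
lemma map_driving (h : IsModel P lam ξ w τ) :
    P.map (driving ξ w τ) = (iidLaw (driveLaw P ξ τ)).prod (P.map w) := by
  have := h.isProbabilityMeasure_map_step
  have := h.isProbabilityMeasure_map_hold
  have := h.isProbabilityMeasure_map_env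
  have := h.isProbabilityMeasure_driveLaw
  have : IsProbabilityMeasure (P.map τ) :=
    Measure.isProbabilityMeasure_map h.measurable_hold.aemeasurable
  have : IsProbabilityMeasure (P.map ξ) :=
    Measure.isProbabilityMeasure_map h.measurable_step.aemeasurable
  have hwτ := (indepFun_iff_map_prod_eq_prod_map_map h.measurable_env.aemeasurable
    h.measurable_hold.aemeasurable).1 h.env_indep_hold
  have hall := (indepFun_iff_map_prod_eq_prod_map_map h.measurable_step.aemeasurable
    (h.measurable_env.prodMk h.measurable_hold).aemeasurable).1 h.step_indep_env_hold
  rw [hwτ] at hall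
  have hpair : iidLaw (driveLaw P ξ τ) = ((P.map ξ).prod (P.map τ)).map pairAlong := by
    rw [h.map_steps, map_pairAlong h.map_holds]
    rfl
  have hpm := measurable_pairAlong (D := ℝ≥0 → ℝ≥0)
  refine Measure.ext_of_lintegral _ fun f hf => ?_
  have hF : Measurable fun q : (ℕ → ℤ) × (ℤ → ℝ≥0) × (ℤ → ℕ → ℝ≥0 → ℝ≥0) =>
      f (pairAlong (q.1, q.2.2), q.2.1) := by fun_prop
  have hF' : Measurable fun q : ((ℕ → ℤ) × (ℤ → ℝ≥0)) × (ℤ → ℕ → ℝ≥0 → ℝ≥0) =>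
      f (pairAlong (q.1.1, q.2), q.1.2) := by fun_prop
  -- Bring the environment to the outside by Fubini; for a frozen environment `map_pairAlong`
  -- applies to steps and holding times.
  calc ∫⁻ p, f p ∂P.map (driving ξ w τ)
      = ∫⁻ q, f (pairAlong (q.1, q.2.2), q.2.1) ∂P.map fun ω => (ξ ω, w ω, τ ω) := by
        rw [lintegral_map hf h.measurable_driving, lintegral_map hF
          (h.measurable_step.prodMk (h.measurable_env.prodMk h.measurable_hold))]
        rfl
    _ = ∫⁻ x, ∫⁻ v, ∫⁻ θ, f (pairAlong (x, θ), v) ∂P.map τ ∂P.map w ∂P.map ξ := by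
        rw [hall, lintegral_prod _ hF.aemeasurable]
        refine lintegral_congr fun x => ?_
        rw [lintegral_prod _ (by fun_prop)]
    _ = ∫⁻ v, ∫⁻ x, ∫⁻ θ, f (pairAlong (x, θ), v) ∂P.map τ ∂P.map ξ ∂P.map w :=
        lintegral_lintegral_swap hF'.lintegral_prod_right'.aemeasurable
    _ = ∫⁻ p, f p ∂(iidLaw (driveLaw P ξ τ)).prod (P.map w) := by
        rw [lintegral_prod_symm' _ hf]
        refine lintegral_congr fun v => ?_
        rw [hpair, lintegral_map (by fun_prop) hpm, lintegral_prod _ (by fun_prop)]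

lemma driveLaw_right (h : IsModel P lam ξ w τ) :
    driveLaw P ξ τ {b | signStep b = 1} = ENNReal.ofReal (stepProb lam) := by
  have := h.isProbabilityMeasure_map_hold
  have e : {b | signStep b = 1} = {(1 : ℤ)} ×ˢ (Set.univ : Set (ℝ≥0 → ℝ≥0)) := by
    ext b
    simp [signStep]
  rw [e, driveLaw, Measure.prod_prod, measure_univ, mul_one,
    Measure.map_apply (h.measurable_step_apply 0) (measurableSet_singleton 1), ← h.step_right 0]
  rfl

lemma integral_signStep (h : IsModel P lam ξ w τ) :
    ∫ b, (signStep b : ℝ) ∂driveLaw P ξ τ = Real.tanh lam := by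
  have := h.isProbabilityMeasure_driveLaw
  have hm : MeasurableSet {b | signStep b = 1} := measurable_signStep (measurableSet_singleton 1)
  have e (b) : (signStep b : ℝ) = 2 * {b | signStep b = 1}.indicator 1 b - 1 := by
    rcases signStep_eq_or b with hb | hb
    · rw [Set.indicator_of_mem (by exact hb), hb]
      norm_num
    · rw [Set.indicator_of_notMem (by simp [hb]), hb]
      norm_num
  have hi : Integrable ({b | signStep b = 1}.indicator (1 : ℤ × (ℝ≥0 → ℝ≥0) → ℝ)) (driveLaw P ξ τ) :=
    (integrable_const 1).indicator hm
  simp only [e]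
  rw [integral_sub (hi.const_mul 2) (integrable_const _), integral_const_mul,
    integral_indicator_one hm, measureReal_def, h.driveLaw_right,
    ENNReal.toReal_ofReal (stepProb_pos lam).le, ← two_mul_stepProb_sub_one]
  simp

lemma ergodic_envStep (h : IsModel P lam ξ w τ) :
    Ergodic (envStep signStep) ((iidLaw (driveLaw P ξ τ)).prod (P.map w)) := by
  have := h.isProbabilityMeasure_map_env
  have := h.isProbabilityMeasure_driveLaw
  refine TrappedWalk.ergodic_envStep _ measurable_signStep ?_ h.env_ergodic
  rw [h.driveLaw_right]
  simpa using stepProb_pos lam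

lemma ae_pathSum_driving (h : IsModel P lam ξ w τ) :
    ∀ᵐ ω ∂P, ∀ n, pathSum signStep n (driving ξ w τ ω).1 = walk ξ n ω := by
  filter_upwards [h.ae_step] with ω hω n
  refine Finset.sum_congr rfl fun k _ => ?_
  rcases hω k with hk | hk <;> simp [driving, pairAlong, signStep, hk]

lemma ae_birkhoffSum_driving (h : IsModel P lam ξ w τ) :
    ∀ᵐ ω ∂P, ∀ n, birkhoffSum (envStep signStep) currentHold n (driving ξ w τ ω) =
      jumpTime ξ w τ n ω := by
  filter_upwards [h.ae_pathSum_driving] with ω hω n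
  rw [birkhoffSum_currentHold, jumpTime]
  refine Finset.sum_congr rfl fun k _ => ?_
  rw [hω, ← (h.hold_cadlag ω (walk ξ k ω) k).evalRight_eq]
  rfl

/-- Given the environment, the mean holding time at the origin is `w 0` by `hold_mean`. The integral
is pulled back to `Ω`, where paths are càdlàg and `evalRight` is true evaluation. -/
lemma lintegral_currentHold (h : IsModel P lam ξ w τ) :
    ∫⁻ p, currentHold p ∂(iidLaw (driveLaw P ξ τ)).prod (P.map w) = ∫⁻ ω, w ω 0 ∂P := by
  have := h.isProbabilityMeasure_map_env
  have := h.isProbabilityMeasure_driveLaw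
  have := h.isProbabilityMeasure_map_hold
  have := h.isProbabilityMeasure_map_step
  have hm : Measurable fun p => (currentHold p : ℝ≥0∞) := measurable_currentHold.coe_nnreal_ennreal
  rw [lintegral_prod_symm' _ hm, lintegral_map hm.lintegral_prod_left' h.measurable_env]
  refine lintegral_congr fun ω => ?_
  have he : Measurable fun σ : ℝ≥0 → ℝ≥0 => (evalRight σ (w ω 0) : ℝ≥0∞) :=
    (measurable_evalRight.comp (measurable_id.prodMk measurable_const)).coe_nnreal_ennreal
  have h1 := ((measurePreserving_snd (μ := P.map fun ω => ξ ω 0)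
    (ν := P.map fun ω => τ ω 0 0)).comp
    (measurePreserving_eval_infinitePi (fun _ : ℕ => driveLaw P ξ τ) 0)).lintegral_comp he
  refine h1.trans ?_
  rw [lintegral_map he (h.measurable_hold_apply 0 0), ← h.hold_mean 0 0 (w ω 0)]
  refine lintegral_congr fun ω' => ?_
  rw [(h.hold_cadlag ω' 0 0).evalRight_eq]

lemma lintegral_env_ne_zero (h : IsModel P lam ξ w τ) : ∫⁻ ω, (w ω 0 : ℝ≥0∞) ∂P ≠ 0 := by
  have hm : Measurable fun ω => (w ω 0 : ℝ≥0∞) :=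
    ((measurable_pi_apply 0).comp h.measurable_env).coe_nnreal_ennreal
  rw [Ne, lintegral_eq_zero_iff hm]
  intro h0
  obtain ⟨ω, h1, h2⟩ := (h0.and (h.env_pos 0)).exists
  exact h2.ne' (by simpa using h1)

lemma ae_of_driving (h : IsModel P lam ξ w τ) {p : (ℕ → ℤ × (ℝ≥0 → ℝ≥0)) × (ℤ → ℝ≥0) → Prop}
    (hp : ∀ᵐ x ∂(iidLaw (driveLaw P ξ τ)).prod (P.map w), p x) :
    ∀ᵐ ω ∂P, p (driving ξ w τ ω) :=
  ae_of_ae_map h.measurable_driving.aemeasurable (h.map_driving ▸ hp)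

/-- The law of large numbers for the walk. -/
lemma ae_tendsto_walk_div (h : IsModel P lam ξ w τ) :
    ∀ᵐ ω ∂P, Tendsto (fun n : ℕ => (walk ξ n ω : ℝ) / n) atTop (𝓝 (Real.tanh lam)) := by
  have := h.isProbabilityMeasure_map_env
  have := h.isProbabilityMeasure_driveLaw
  have hpos : driveLaw P ξ τ {b | signStep b = 1} ≠ 0 := by
    rw [h.driveLaw_right]
    simpa using stepProb_pos lam
  filter_upwards [h.ae_of_driving (ae_tendsto_pathSum_div _ measurable_signStep signStep_eq_or
    hpos h.env_ergodic), h.ae_pathSum_driving] with ω h1 h2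
  simpa only [h2, h.integral_signStep] using h1

/-- The law of large numbers for the jump times. -/
lemma ae_tendsto_div_jumpTime (h : IsModel P lam ξ w τ) :
    ∀ᵐ ω ∂P, Tendsto (fun n => jumpTime ξ w τ n ω) atTop atTop ∧
      Tendsto (fun n : ℕ => (n : ℝ) / jumpTime ξ w τ n ω) atTop
        (𝓝 (∫⁻ ω, (w ω 0 : ℝ≥0∞) ∂P)⁻¹.toReal) := by
  have := h.isProbabilityMeasure_map_env
  have := h.isProbabilityMeasure_driveLaw
  have hm := measurable_currentHold
  have hcast (n : ℕ) (p) : birkhoffSum (envStep signStep) (fun p => (currentHold p : ℝ)) n p =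
      (birkhoffSum (envStep signStep) currentHold n p : ℝ≥0) := by simp [birkhoffSum]
  by_cases hinf : ∫⁻ ω, (w ω 0 : ℝ≥0∞) ∂P = ∞
  · filter_upwards [h.ae_of_driving (ae_tendsto_birkhoffSum_div_atTop h.ergodic_envStep hm
      (h.lintegral_currentHold.trans hinf)), h.ae_birkhoffSum_driving] with ω h1 h2
    simp only [hcast, h2] at h1
    refine ⟨?_, ?_⟩
    · rw [← NNReal.tendsto_coe_atTop]
      refine (h1.atTop_mul_atTop₀ tendsto_natCast_atTop_atTop).congr' ?_
      filter_upwards [eventually_ne_atTop 0] with n hn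
      have : (n : ℝ) ≠ 0 := by exact_mod_cast hn
      field_simp
    -- In `ℝ≥0∞` the inverse of `∞` is `0`, so the claim here is that `n / T n` tends to `0`.
    · rw [hinf]
      simp only [ENNReal.inv_top, ENNReal.toReal_zero]
      refine h1.inv_tendsto_atTop.congr fun n => ?_
      rw [Pi.inv_apply, inv_div]
  · have hi : Integrable (fun p => (currentHold p : ℝ))
        ((iidLaw (driveLaw P ξ τ)).prod (P.map w)) := by
      refine ⟨hm.coe_nnreal_real.aestronglyMeasurable, ?_⟩
      rw [HasFiniteIntegral]
      simpa [h.lintegral_currentHold, lt_top_iff_ne_top] using hinf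
    have hint : ∫ p, (currentHold p : ℝ) ∂(iidLaw (driveLaw P ξ τ)).prod (P.map w) =
        (∫⁻ ω, (w ω 0 : ℝ≥0∞) ∂P).toReal := by
      rw [integral_eq_lintegral_of_nonneg_ae (ae_of_all _ fun _ => NNReal.coe_nonneg _)
        hm.coe_nnreal_real.aestronglyMeasurable, ← h.lintegral_currentHold]
      simp
    -- Positivity of the environment enters here: it makes `T n` diverge and the limit of `T n / n`
    -- invertible.
    have hpos : 0 < (∫⁻ ω, (w ω 0 : ℝ≥0∞) ∂P).toReal :=
      ENNReal.toReal_pos h.lintegral_env_ne_zero hinf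
    filter_upwards [h.ae_of_driving (ae_tendsto_birkhoffSum_div h.ergodic_envStep
      hm.coe_nnreal_real hi), h.ae_birkhoffSum_driving] with ω h1 h2
    simp only [hcast, h2, hint] at h1
    refine ⟨?_, ?_⟩
    · rw [← NNReal.tendsto_coe_atTop]
      refine (h1.pos_mul_atTop hpos tendsto_natCast_atTop_atTop).congr' ?_
      filter_upwards [eventually_ne_atTop 0] with n hn
      have : (n : ℝ) ≠ 0 := by exact_mod_cast hn
      field_simp
    · rw [ENNReal.toReal_inv]
      simpa using h1.inv₀ hpos.ne'

lemma escapeProb_eq (h : IsModel P lam ξ w τ) (hlam : 0 < lam) :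
    escapeProb P ξ = ENNReal.ofReal (Real.tanh lam) := by
  have := h.isProbabilityMeasure_map_env
  have := h.isProbabilityMeasure_driveLaw
  have hpos : driveLaw P ξ τ {b | signStep b = 1} ≠ 0 := by
    rw [h.driveLaw_right]
    simpa using stepProb_pos lam
  have htanh : 0 < Real.tanh lam := by
    rw [Real.tanh_eq_sinh_div_cosh]
    exact div_pos (Real.sinh_pos_iff.2 hlam) (Real.cosh_pos lam)
  have hm : MeasurableSet {p : (ℕ → ℤ × (ℝ≥0 → ℝ≥0)) × (ℤ → ℝ≥0) |
      ∀ n, 1 ≤ n → pathSum signStep n p.1 ≠ 0} := by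
    simp only [Set.ofPred_forall]
    refine .iInter fun n => .iInter fun _ => ?_
    exact ((measurable_pathSum measurable_signStep n).comp measurable_fst)
      (measurableSet_singleton 0).compl
  have h1 := measure_forall_pathSum_ne_zero (driveLaw P ξ τ) measurable_signStep signStep_eq_or
    hpos h.env_ergodic (by rwa [h.integral_signStep])
  rw [← h.map_driving, Measure.map_apply h.measurable_driving hm, h.integral_signStep] at h1
  rw [← h1, escapeProb]
  refine measure_congr (eventuallyEq_set.2 ?_)
  filter_upwards [h.ae_pathSum_driving] with ω hω
  simp [hω]

end IsModel

end Model

end TrappedWalk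

end

theorem theorem1 {Ω : Type*} [MeasurableSpace Ω] (P : Measure Ω) [IsProbabilityMeasure P]
    (lam : ℝ) (hlam : 0 < lam)
    (ξ : Ω → ℕ → ℤ) (w : Ω → ℤ → ℝ≥0) (τ : Ω → ℤ → ℕ → ℝ≥0 → ℝ≥0)
    (hmodel : TrappedWalk.IsModel P lam ξ w τ) :
    -- the escape probability is `tanh lam`
    TrappedWalk.escapeProb P ξ = ENNReal.ofReal (Real.tanh lam) ∧
    -- almost surely, `X t` is well defined for all `t ≥ 0`
    (∀ᵐ ω ∂P, ∀ t : ℝ≥0, ∃! k : ℕ,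
      TrappedWalk.jumpTime ξ w τ k ω ≤ t ∧ t < TrappedWalk.jumpTime ξ w τ (k + 1) ω) ∧
    -- almost surely, `X t / t` tends to `p_esc / E[w 0]`, which is `0` if `E[w 0] = ∞`
    (∀ᵐ ω ∂P, Tendsto
      (fun t : ℝ≥0 => (TrappedWalk.position ξ w τ t ω : ℝ) / (t : ℝ)) atTop
      (𝓝 (TrappedWalk.escapeProb P ξ / ∫⁻ ω', (w ω' 0 : ℝ≥0∞) ∂P).toReal)) := by
  have hesc := hmodel.escapeProb_eq hlam
  refine ⟨hesc, ?_, ?_⟩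
  · filter_upwards [hmodel.ae_tendsto_div_jumpTime] with ω hω
    exact TrappedWalk.existsUnique_mem_interval (by simp [TrappedWalk.jumpTime])
      TrappedWalk.monotone_jumpTime hω.1
  · filter_upwards [hmodel.ae_tendsto_div_jumpTime, hmodel.ae_tendsto_walk_div] with ω h1 h2
    have htanh : 0 ≤ Real.tanh lam := by
      rw [Real.tanh_eq_sinh_div_cosh]
      exact div_nonneg (Real.sinh_nonneg_iff.2 hlam.le) (Real.cosh_pos lam).le
    rw [hesc, div_eq_mul_inv, ENNReal.toReal_mul, ENNReal.toReal_ofReal htanh]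
    exact TrappedWalk.tendsto_position_div h1.1 h2 h1.2
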